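/- **Setting.** Let $G$ be a finite connected simple graph with vertex set $V$, $\nu=|V|$, and let $\mathcal T_1,\mathcal T_2$ be two partitions of $V$ into cliques (polygons) such that every edge of $G$ lies inside a polygon of $\mathcal T_1$ or of $\mathcal T_2$; put $m=|\mathcal T_1|$, $n=|\mathcal T_2|$. Let $\mathcal T_k(u)$ be the polygon of $\mathcal T_k$ containing $u$. To each polygon assign a unit vector $|\alpha\rangle$ ($\alpha\in\mathcal T_1$), $|\beta\rangle$ ($\beta\in\mathcal T_2$) of $\mathcal H=\ell^2(V)$ whose support is exactly that polygon, and put $a(u)=\langle u|\mathcal T_1(u)\rangle$, $b(u)=\langle u|\mathcal T_2(u)\rangle$. Let $A,B$ be the matrices with columns $|\alpha\rangle$, $|\beta\rangle$, let $\mathcal A,\mathcal B$ be their column spaces, $H_A=2AA^\dagger-I$, $H_B=2BB^\dagger-I$, and for $\theta\in(0,\pi)$ let $U_\theta=-e^{i\theta H_B}e^{i\theta H_A}$. Let $T=\begin{bmatrix}0&A^\dagger B\\B^\dagger A&0\end{bmatrix}$ on $\ell^2(\mathcal T_1)\oplus\ell^2(\mathcal T_2)$. A reversible eigenfunction is an eigenfunction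 $\pi=\pi_1\oplus\pi_2$ of $T$ with $a(u)\pi(\mathcal T_1(u))=b(u)\pi(\mathcal T_2(u))$ for all $u\in V$; $T$ is reversible if one exists. For $\mu\in[-1,1]$ let $\phi(\mu)$ be the angle with $\cos\phi(\mu)=\mu\sin\theta$ that lies in $[0,\pi]$ if $\theta\le\pi/2$ and in $[-\pi,0]$ if $\theta>\pi/2$ (so $\phi(1)=\pi/2-\theta$), and let $\phi_-=\pi/2+\theta$. Let $G_{\rm un}$ be the connected bipartite multigraph with vertex set $\mathcal T_1\sqcup\mathcal T_2$ and edge set $V$, where $u$ joins $\mathcal T_1(u)$ and $\mathcal T_2(u)$, and let $b_1=\nu-(m+n)+1$ be its first Betti number. For an edge $u$ and an endpoint $x$ of it put $w(u,x)=a(u)$ if $x\in\mathcal T_1$ and $w(u,x)=b(u)$ if $x\in\mathcal T_2$. For a walk $p=(x_0,e_1,x_1,\dots,e_r,x_r)$ in $G_{\rm un}$ put $\kappa(p)=\prod_{i=1}^r w(e_i,x_i)/w(e_i,x_{i-1})$, and for a cycle $c$ put $\Delta(c)=\kappa(c)-1$. For $z\in\mathbb C$ let $\psi_{p,z}$ be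 the function on $V$ supported on the edges of $p$ with $\overline{w(e_1,x_0)}\,\psi(e_1)=z$ and $\overline{w(e_i,x_i)}\,\psi(e_i)+\overline{w(e_{i+1},x_i)}\,\psi(e_{i+1})=0$ for $1\le i<r$. Fix a spanning tree of $G_{\rm un}$ and let $\Gamma$ be the set of its fundamental cycles, one for each edge outside the tree. For a cycle $c$ with first edge $e_1$ and base vertex $x_0$ let $\psi_c=\psi_{c,z}$ with $z=\overline{w(e_1,x_0)}$, so $\psi_c(e_1)=1$. Given $c_0,c\in\Gamma$, $c\ne c_0$, a cycle-path joining them consists of base vertices $x$ of $c_0$ and $y$ of $c$ and a path $p$ of length $\ell$ from $x$ to $y$ without edges of $c_0$ and $c$, where $x=y$ and $\ell=0$ if $c_0$ and $c$ have a common vertex. With $h=w(e_1,x)$, $e_1$ the first edge of $c_0$, put $$\psi_c^{c_0}=\psi_{c_0,\overline h}+\psi_{p,\overline{h\Delta(c_0)}}+\psi_{c,\overline{z}},\qquad z=(-1)^{\ell+1}\,\frac{\kappa(p)\,h\,\Delta(c_0)}{\Delta(c)}\quad\text{if }\Delta(c)\neq0,$$ and $\psi_c^{c_0}=\psi_c$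 if $\Delta(c)=0$. **Theorem.** $\mathcal A+\mathcal B$ and $(\mathcal A+\mathcal B)^\perp$ are invariant under $U_\theta$, so $U_\theta=U_\theta|_{\mathcal A+\mathcal B}\oplus U_\theta|_{(\mathcal A+\mathcal B)^\perp}$ on $\mathcal H=(\mathcal A+\mathcal B)\oplus(\mathcal A+\mathcal B)^\perp$. 1. Space $\mathcal A+\mathcal B$. $$\sigma(U_\theta|_{\mathcal A+\mathcal B})=\begin{cases}\{e^{2i\phi(\mu)}:\mu\in\sigma(T)\}&\text{if }T\text{ is nonreversible},\\ \{e^{2i\phi(\mu)}:\mu\in\sigma(T)\setminus\{1\}\}&\text{if }T\text{ is reversible and }\theta\ne\pi/2,\\ \{e^{2i\phi(\mu)}:\mu\in\sigma(T)\setminus\{-1\}\}&\text{if }T\text{ is reversible and }\theta=\pi/2.\end{cases}$$ (If $T$ is reversible and $\theta>\pi/2$, this set also equals $\{e^{2i\arccos(\mu\sin\theta)}:\mu\in\sigma(T)\setminus\{-1\}\}$.) For every $\phi\in\mathbb R$, $$\ker(U_\theta|_{\mathcal A+\mathcal B}-e^{2i\phi})=\begin{cases}\{Af+ie^{i(\theta+\phi)}Bg: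 f\oplus g\in\ker(\tfrac{\cos\phi}{\sin\theta}-T)\}&\text{if }\phi\not\equiv\phi_-\ (\mathrm{mod}\ \pi),\\ \mathcal A\cap\mathcal B&\text{if }\phi\equiv\phi_-\ (\mathrm{mod}\ \pi)\text{ and }T\text{ is reversible},\\ 0&\text{if }\phi\equiv\phi_-\ (\mathrm{mod}\ \pi)\text{ and }T\text{ is nonreversible},\end{cases}$$ and every reversible eigenfunction $\pi_1\oplus\pi_2$ lies in $\ker(1-T)$ and satisfies $\mathcal A\cap\mathcal B=\mathbb C A\pi_1$. 2. Space $(\mathcal A+\mathcal B)^\perp$. The spectrum $\sigma(U_\theta|_{(\mathcal A+\mathcal B)^\perp})$ is empty if $G_{\rm un}$ is a tree, or if $b_1=1$ and $T$ is nonreversible; otherwise it is $\{-e^{-2i\theta}\}$. The dimension of $(\mathcal A+\mathcal B)^\perp$ is $b_1=\nu-(m+n)+1$ if $T$ is reversible and $b_1-1=\nu-(m+n)$ otherwise. For every spanning tree of $G_{\rm un}$, each edge outside the tree has a fundamental cycle, and: - if $T$ is reversible, then $\ker(U_\theta|_{(\mathcal A+\mathcal B)^\perp}+e^{-2i\theta})=\mathrm{span}\{\psi_c: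 c\in\Gamma\}$ for any choice of base vertices and orientations, and the support of $\psi_c$ is the edge set of $c$; - if $T$ is nonreversible, then some $c_0\in\Gamma$ has $\Delta(c_0)\ne0$. For each such $c_0$ and each $c\in\Gamma\setminus\{c_0\}$ there is a cycle-path whose path lies in the tree; for every cycle-path, $\psi_c^{c_0}$ is a nonzero element of $\ker(U_\theta|_{(\mathcal A+\mathcal B)^\perp}+e^{-2i\theta})$, whose support is the edge set of the cycle-path if $\Delta(c)\neq0$ and $c_0,c$ have no common edge; and, for any choice of cycle-paths with paths in the tree, $\ker(U_\theta|_{(\mathcal A+\mathcal B)^\perp}+e^{-2i\theta})=\mathrm{span}\{\psi_c^{c_0}: c\in\Gamma\setminus\{c_0\}\}$. -/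

import Mathlib

open scoped Matrix ComplexConjugate

noncomputable section

/-! ### Walks, cycles and spanning trees in multigraphs -/

/-- Walks in a multigraph; every step records the edge that is traversed. -/
inductive MultiWalk {α β : Type*} (Γ : Graph α β) : α → α → Type _
  | nil (x : α) : MultiWalk Γ x x
  | cons {x y z : α} (e : β) (h : Γ.IsLink e x y) (p : MultiWalk Γ y z) : MultiWalk Γ x z

namespace MultiWalk

variable {α β : Type*} {Γ : Graph α β}

/-- The traversed edges, in order. -/
def edges : {x y : α} → MultiWalk Γ x y → List β
  | _, _, nil _ => []
  | _, _, cons e _ p => e :: p.edges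

/-- The visited vertices, in order, including both endpoints. -/
def support : {x y : α} → MultiWalk Γ x y → List α
  | _, _, nil x => [x]
  | x, _, cons _ _ p => x :: p.support

/-- A path visits no vertex twice. -/
def IsPath {x y : α} (p : MultiWalk Γ x y) : Prop := p.support.Nodup

/-- A cycle is a nonempty closed walk that repeats neither an edge nor a vertex, except that the
base vertex is both first and last. Two parallel edges form a cycle of length two. -/
structure IsCycle {x : α} (c : MultiWalk Γ x x) : Prop where
  edges_ne_nil : c.edges ≠ []
  edges_nodup : c.edges.Nodup
  support_nodup : c.support.tail.Nodup

end MultiWalk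

/-- The set `S` of edges of `Γ` forms a spanning tree: it connects any two vertices of `Γ` and it
contains no cycle. -/
structure IsSpanningTree {α β : Type*} (Γ : Graph α β) (S : Set β) : Prop where
  subset : S ⊆ Γ.edgeSet
  connected : ∀ x ∈ Γ.vertexSet, ∀ y ∈ Γ.vertexSet,
    ∃ p : MultiWalk Γ x y, ∀ e ∈ p.edges, e ∈ S
  acyclic : ∀ (x : α) (c : MultiWalk Γ x x), c.IsCycle → ¬ ∀ e ∈ c.edges, e ∈ S

/-- The multigraph `Γ` is a tree. -/
def IsMultiTree {α β : Type*} (Γ : Graph α β) : Prop := IsSpanningTree Γ Γ.edgeSet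

/-- `c` runs around the fundamental cycle that arises by adding the edge `e` to `S`. The base
vertex and the orientation are arbitrary. -/
structure IsFundamentalCycle {α β : Type*} {Γ : Graph α β} (S : Set β) (e : β) {x : α}
    (c : MultiWalk Γ x x) : Prop where
  isCycle : c.IsCycle
  mem : e ∈ c.edges
  subset : ∀ e' ∈ c.edges, e' = e ∨ e' ∈ S

/-! ### Tessellations and 2-tessellable quantum walks -/

/-- A tessellation of `G`: a partition of the vertices (given as an equivalence relation) into
cliques. -/
structure Tessellation {V : Type*} (G : SimpleGraph V) where
  rel : Setoid V
  isClique : ∀ u v, rel u v → u ≠ v → G.Adj u v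

namespace Tessellation

variable {V : Type*} {G : SimpleGraph V}

/-- The polygons (tiles) of a tessellation. -/
def Tile (𝒯 : Tessellation G) : Type _ := Quotient 𝒯.rel

/-- The polygon that contains the vertex `u`. -/
def tile (𝒯 : Tessellation G) (u : V) : 𝒯.Tile := Quotient.mk 𝒯.rel u

instance (𝒯 : Tessellation G) [Finite V] : Fintype 𝒯.Tile :=
  @Fintype.ofFinite _ (inferInstanceAs (Finite (Quotient 𝒯.rel)))

instance (𝒯 : Tessellation G) : DecidableEq 𝒯.Tile := Classical.decEq _

end Tessellation

/-- The data of a 2-tessellable quantum walk on `G`: two tessellations that cover the edges of `G`,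
and for every polygon a unit vector of `ℓ²(V)` whose support is that polygon. -/
structure StaggeredWalk {V : Type*} [Fintype V] (G : SimpleGraph V) where
  T₁ : Tessellation G
  T₂ : Tessellation G
  cover : ∀ u v, G.Adj u v → T₁.rel u v ∨ T₂.rel u v
  α : T₁.Tile → EuclideanSpace ℂ V
  β : T₂.Tile → EuclideanSpace ℂ V
  norm_α : ∀ i, ‖α i‖ = 1
  norm_β : ∀ j, ‖β j‖ = 1
  α_ne_zero_iff : ∀ i u, α i u ≠ 0 ↔ T₁.tile u = i
  β_ne_zero_iff : ∀ j u, β j u ≠ 0 ↔ T₂.tile u = j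

/-- The boundary angle `φ₋ = π/2 + θ`. -/
def phiMinus (θ : ℝ) : ℝ := Real.pi / 2 + θ

/-- The angle `φ(μ)` with `cos φ(μ) = μ sin θ`. It lies in `[0, π]` if `θ ≤ π/2` and in `[-π, 0]`
otherwise; with this choice of the branch `φ(1) = φ₊ = π/2 - θ` for all `θ`. -/
def phase (θ μ : ℝ) : ℝ :=
  if θ ≤ Real.pi / 2 then Real.arccos (μ * Real.sin θ) else -Real.arccos (μ * Real.sin θ)

namespace StaggeredWalk

variable {V : Type*} [Fintype V] {G : SimpleGraph V} (W : StaggeredWalk G)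

/-- `a(u) = ⟨u|α⟩` for the polygon `α ∋ u` of the first tessellation. -/
def a (u : V) : ℂ := W.α (W.T₁.tile u) u

/-- `b(u) = ⟨u|β⟩` for the polygon `β ∋ u` of the second tessellation. -/
def b (u : V) : ℂ := W.β (W.T₂.tile u) u

/-- The matrix with columns `|α_i⟩`. -/
def A : Matrix V W.T₁.Tile ℂ := Matrix.of fun u i => W.α i u

/-- The matrix with columns `|β_j⟩`. -/
def B : Matrix V W.T₂.Tile ℂ := Matrix.of fun u j => W.β j u

/-- The subspace `𝒜` spanned by the vectors `|α_i⟩`. -/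
def spaceA : Submodule ℂ (EuclideanSpace ℂ V) := Submodule.span ℂ (Set.range W.α)

/-- The subspace `ℬ` spanned by the vectors `|β_j⟩`. -/
def spaceB : Submodule ℂ (EuclideanSpace ℂ V) := Submodule.span ℂ (Set.range W.β)

/-- `A f` as a vector of `ℓ²(V)`. -/
def liftA (f : W.T₁.Tile → ℂ) : EuclideanSpace ℂ V := WithLp.toLp 2 (W.A *ᵥ f)

/-- `B g` as a vector of `ℓ²(V)`. -/
def liftB (g : W.T₂.Tile → ℂ) : EuclideanSpace ℂ V := WithLp.toLp 2 (W.B *ᵥ g)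

/-- The Hamiltonian `H_A = 2 A A† - I`. -/
def hamA [DecidableEq V] : Matrix V V ℂ := (2 : ℂ) • (W.A * W.Aᴴ) - 1

/-- The Hamiltonian `H_B = 2 B B† - I`. -/
def hamB [DecidableEq V] : Matrix V V ℂ := (2 : ℂ) • (W.B * W.Bᴴ) - 1

/-- The evolution operator `U_θ = - e^{iθ H_B} e^{iθ H_A}` on `ℓ²(V)`. -/
def U [DecidableEq V] (θ : ℝ) : Module.End ℂ (EuclideanSpace ℂ V) :=
  Matrix.toEuclideanLin
    (-(NormedSpace.exp ((Complex.I * (θ : ℂ)) • W.hamB) *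
      NormedSpace.exp ((Complex.I * (θ : ℂ)) • W.hamA)))

/-- The discriminant `T = [[0, A†B], [B†A, 0]]`. -/
def T : Matrix (W.T₁.Tile ⊕ W.T₂.Tile) (W.T₁.Tile ⊕ W.T₂.Tile) ℂ :=
  Matrix.fromBlocks 0 (W.Aᴴ * W.B) (W.Bᴴ * W.A) 0

/-- A reversible eigenfunction: an eigenfunction of `T` that satisfies the quantum detailed balance
conditions. -/
def IsReversibleEigenfunction (ϖ : W.T₁.Tile ⊕ W.T₂.Tile → ℂ) : Prop :=
  ϖ ≠ 0 ∧ (∃ μ : ℂ, W.T *ᵥ ϖ = μ • ϖ) ∧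
    ∀ u, W.a u * ϖ (Sum.inl (W.T₁.tile u)) = W.b u * ϖ (Sum.inr (W.T₂.tile u))

/-- `T` is reversible. -/
def Reversible : Prop := ∃ ϖ, W.IsReversibleEigenfunction ϖ

/-- The underlying bipartite multigraph: its vertices are the polygons of both tessellations, its
edges are the vertices `u` of `G`, and `u` joins the two polygons that contain `u`. -/
def underlying : Graph (W.T₁.Tile ⊕ W.T₂.Tile) V where
  vertexSet := Set.univ
  edgeSet := Set.univ
  IsLink u x y :=
    (x = Sum.inl (W.T₁.tile u) ∧ y = Sum.inr (W.T₂.tile u)) ∨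
    (x = Sum.inr (W.T₂.tile u) ∧ y = Sum.inl (W.T₁.tile u))
  isLink_symm := by
    intro u _
    refine ⟨fun x y h => ?_⟩
    rcases h with ⟨h, h'⟩ | ⟨h, h'⟩
    · exact Or.inr ⟨h', h⟩
    · exact Or.inl ⟨h', h⟩
  eq_or_eq_of_isLink_of_isLink := by
    rintro u x y v w (⟨rfl, rfl⟩ | ⟨rfl, rfl⟩) (⟨rfl, rfl⟩ | ⟨rfl, rfl⟩) <;> simp
  edge_mem_iff_exists_isLink := by
    intro u
    simp only [Set.mem_univ, true_iff]
    exact ⟨_, _, Or.inl ⟨rfl, rfl⟩⟩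
  left_mem_of_isLink := by
    intros
    trivial

/-- The first Betti number `|E| - |V| + 1` of the (connected) underlying multigraph. -/
def betti : ℤ :=
  (Fintype.card V : ℤ) - (Fintype.card W.T₁.Tile + Fintype.card W.T₂.Tile : ℤ) + 1

/-! ### Cycle eigenvectors and cycle-path eigenvectors -/

/-- The amplitude of the edge `u` at its endpoint `x`: `a(u)` at polygons of the first tessellation,
`b(u)` at polygons of the second one. -/
def amp (u : V) : W.T₁.Tile ⊕ W.T₂.Tile → ℂ
  | Sum.inl _ => W.a u
  | Sum.inr _ => W.b u

/-- The amplitude of the first edge at the starting vertex. -/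
def headAmp : {x y : W.T₁.Tile ⊕ W.T₂.Tile} → MultiWalk W.underlying x y → ℂ
  | _, _, .nil _ => 1
  | x, _, .cons e _ _ => W.amp e x

/-- The product, over the steps `x —e→ y` of the walk, of `amp e y / amp e x`. For a cycle
`e₁, …, e₂ₖ` based at a polygon of the first tessellation it is
`(a(e₂ₖ) b(e₂ₖ₋₁) ⋯ a(e₂) b(e₁)) / (b(e₂ₖ) a(e₂ₖ₋₁) ⋯ b(e₂) a(e₁))`; for a path it is `κ(p)`. -/
def kappa : {x y : W.T₁.Tile ⊕ W.T₂.Tile} → MultiWalk W.underlying x y → ℂ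
  | _, _, .nil _ => 1
  | x, _, .cons (y := y) e _ p => W.amp e y / W.amp e x * kappa p

/-- The balancing index `Δ(c)`. -/
def balance {x : W.T₁.Tile ⊕ W.T₂.Tile} (c : MultiWalk W.underlying x x) : ℂ := W.kappa c - 1

/-- The function `ψ` supported on the edges `e₁, e₂, …` of a walk `x₀, x₁, …` that is determined by
`conj (amp e₁ x₀) ψ(e₁) = z` and by the balance equations
`conj (amp eᵢ xᵢ) ψ(eᵢ) + conj (amp eᵢ₊₁ xᵢ) ψ(eᵢ₊₁) = 0` at the inner vertices `xᵢ`. -/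
def flow [DecidableEq V] :
    {x y : W.T₁.Tile ⊕ W.T₂.Tile} → MultiWalk W.underlying x y → ℂ → V → ℂ
  | _, _, .nil _, _ => 0
  | x, _, .cons (y := y) e _ p, z =>
      Pi.single e (z / conj (W.amp e x)) +
        flow p (-(conj (W.amp e y) * (z / conj (W.amp e x))))

/-- The cycle eigenvector `ψ_c`, normalised by the value `1` at the first edge of `c`. -/
def cycleVec [DecidableEq V] {x : W.T₁.Tile ⊕ W.T₂.Tile} (c : MultiWalk W.underlying x x) :
    EuclideanSpace ℂ V :=
  WithLp.toLp 2 (W.flow c (conj (W.headAmp c)))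

/-- A cycle-path subgraph: the fundamental cycles of the edges `e₀` and `e`, based at `x` and `y`,
and a path from `x` to `y` that shares no edge with them. If the cycles have a common vertex, the
path is trivial, so that `x = y` is a common vertex. -/
structure CyclePath (S : Set V) (e₀ e : V) where
  x : W.T₁.Tile ⊕ W.T₂.Tile
  y : W.T₁.Tile ⊕ W.T₂.Tile
  c₀ : MultiWalk W.underlying x x
  c : MultiWalk W.underlying y y
  p : MultiWalk W.underlying x y
  fund₀ : IsFundamentalCycle S e₀ c₀
  fund : IsFundamentalCycle S e c
  isPath : p.IsPath
  disjoint : ∀ u ∈ p.edges, u ∉ c₀.edges ∧ u ∉ c.edges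
  trivial_of_meet : (∃ v, v ∈ c₀.support ∧ v ∈ c.support) → p.edges = []

/-- The cycle-path eigenvector `ψ_c^{c₀}`. Its values along `c₀` start with `1`, those along the path
`g₁, …, g_ℓ` with `conj ψ(g₁) = amp e₁ x * Δ(c₀) / amp g₁ x`, and those along `c` with
`conj ψ(f₁) = (-1)^(ℓ+1) κ(p) * amp e₁ x * Δ(c₀) / (amp f₁ y * Δ(c))`; values on common edges of the
two cycles add up. If `Δ(c) = 0`, it is the cycle eigenvector `ψ_c`. -/
def cyclePathVec [DecidableEq V] {S : Set V} {e₀ e : V} (D : W.CyclePath S e₀ e) :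
    EuclideanSpace ℂ V :=
  if W.balance D.c = 0 then W.cycleVec D.c
  else WithLp.toLp 2
    (W.flow D.c₀ (conj (W.headAmp D.c₀)) +
      W.flow D.p (conj (W.headAmp D.c₀ * W.balance D.c₀)) +
      W.flow D.c (conj ((-1) ^ (D.p.edges.length + 1) * W.kappa D.p * W.headAmp D.c₀ *
        W.balance D.c₀ / W.balance D.c)))

end StaggeredWalk

end

/-! The columns of `A`, and likewise those of `B`, are unit vectors with disjoint supports. So `AA†`
and `BB†` are orthogonal projections, and `e^{zH_A} = e^{-z} + (e^z - e^{-z}) AA†`. On `(𝒜 + ℬ)ᗮ`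
both projections vanish and `U_θ` is the scalar `-e^{-2iθ}`.

On `𝒜 + ℬ`, moving `e^{iθH_B}` to the other side turns `Uψ = lψ` into the linear equation `-dψ =
s(AA†ψ - l BB†ψ)`, with `d = e^{-iθ} + l e^{iθ}` and `s = 2i sin θ` (`U_apply_eq_smul_iff`). If `d ≠
0`, it exhibits `ψ` as `Af + ηBg`, and applying `A†` and `B†` gives `T(f ⊕ g) = μ(f ⊕ g)` with `μ =
cos φ / sin θ`. Conversely, such pairs lift to solutions. Two values of `l = e^{2iφ}` are special.
For `l = -e^{-2iθ}` one has `d = 0`, and there is no eigenvector in `𝒜 + ℬ` unless `l = 1`. For `l =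
-e^{2iθ}` the eigenspace is `𝒜 ∩ ℬ`. They correspond to `μ = 1` and `μ = -1`, and coincide exactly
at `θ = π/2`. Detailed balance says `Aπ₁ = Bπ₂`, so reversibility means `𝒜 ∩ ℬ ≠ 0`, equivalently
`±1 ∈ σ(T)`. Connectedness makes this intersection at most a line, which fixes the dimension of `(𝒜
+ ℬ)ᗮ`.

That complement is the kernel of a weighted boundary map on the edges of the underlying multigraph.
A function supported on an acyclic edge set vanishes once its boundary is concentrated at one vertex
(`eq_zero_of_bdry_eq_zero`), so a kernel element is determined by its values off a spanning tree.
The flow along a walk has boundary only at the two ends (`bdry_flow`); around a cycle the ends merge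
and leave a defect proportional to `conj Δ(c)`. A reversible eigenfunction makes `κ` telescope, so
every defect vanishes and the fundamental cycles give a basis. Otherwise a dimension count produces
an unbalanced `c₀`; its defect is carried along a path and absorbed by an unbalanced `c`, while a
balanced `c` already gives a kernel vector. Each resulting vector is nonzero at its own non-tree
edge and, if the path lies in the tree, zero at all the others except that of `c₀`. -/

/-! ### Exponentials of reflections -/

theorem exp_smul_of_isIdempotentElem {n : Type*} [Fintype n] [DecidableEq n] {P : Matrix n n ℂ}
    (hP : IsIdempotentElem P) (z : ℂ) :
    NormedSpace.exp (z • P) = 1 + (Complex.exp z - 1) • P := by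
  have h1 : HasSum (fun k : ℕ => ((k.factorial : ℂ)⁻¹ * z ^ k) • P) (Complex.exp z • P) := by
    refine HasSum.smul_const ?_ P
    have := NormedSpace.exp_series_hasSum_exp' (𝕂 := ℂ) z
    rw [← Complex.exp_eq_exp_ℂ] at this
    simpa using this
  have h2 := (hasSum_ite_eq (0 : ℕ) (1 - P)).add h1
  rw [NormedSpace.exp_eq_tsum ℂ]
  -- Every positive power of `P` is `P`; only the zeroth power is `1`, hence the correction `1 - P`
  -- at `k = 0`.
  have h3 : (fun k : ℕ => ((k.factorial : ℂ)⁻¹) • (z • P) ^ k) =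
      fun k : ℕ => (if k = 0 then 1 - P else 0) + ((k.factorial : ℂ)⁻¹ * z ^ k) • P := by
    funext k
    rcases k with _ | k
    · simp
    · rw [smul_pow, hP.pow_succ_eq, smul_smul]
      simp
  simp only [h3]
  rw [h2.tsum_eq, sub_smul, one_smul]
  abel

/-- The exponent splits into the commuting summands `2zP` and `-z`. -/
theorem exp_smul_reflection {n : Type*} [Fintype n] [DecidableEq n] {P : Matrix n n ℂ}
    (hP : IsIdempotentElem P) (z : ℂ) :
    NormedSpace.exp (z • ((2 : ℂ) • P - 1)) =
      Complex.exp (-z) • (1 : Matrix n n ℂ) + (Complex.exp z - Complex.exp (-z)) • P := by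
  have h : z • ((2 : ℂ) • P - 1) = (2 * z) • P + (-z) • (1 : Matrix n n ℂ) := by
    rw [smul_sub, smul_smul, mul_comm z 2, neg_smul, sub_eq_add_neg]
  have e2 : Complex.exp (2 * z) * Complex.exp (-z) = Complex.exp z := by
    rw [← Complex.exp_add]; ring_nf
  rw [h, Matrix.exp_add_of_commute _ _ ((Commute.one_right _).smul_right _),
    exp_smul_of_isIdempotentElem hP, exp_smul_of_isIdempotentElem IsIdempotentElem.one, ← e2]
  have h1 : (1 : Matrix n n ℂ) + (Complex.exp (-z) - 1) • (1 : Matrix n n ℂ) =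
      Complex.exp (-z) • (1 : Matrix n n ℂ) := by module
  rw [h1, mul_smul_comm, mul_one]
  module

/-! ### The isometries `A` and `B` and the sum of their ranges -/

namespace StaggeredWalk

variable {V : Type*} [Fintype V] {G : SimpleGraph V} (W : StaggeredWalk G)

/-- The same walk with the two tessellations exchanged. -/
def swap : StaggeredWalk G where
  T₁ := W.T₂
  T₂ := W.T₁
  cover u v h := (W.cover u v h).symm
  α := W.β
  β := W.α
  norm_α := W.norm_β
  norm_β := W.norm_α
  α_ne_zero_iff := W.β_ne_zero_iff
  β_ne_zero_iff := W.α_ne_zero_iff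

theorem a_ne_zero (u : V) : W.a u ≠ 0 := (W.α_ne_zero_iff _ u).2 rfl

theorem b_ne_zero (u : V) : W.b u ≠ 0 := W.swap.a_ne_zero u

theorem α_apply (i : W.T₁.Tile) (u : V) : W.α i u = if W.T₁.tile u = i then W.a u else 0 := by
  split_ifs with h
  · subst h; rfl
  · exact not_not.1 fun h' => h ((W.α_ne_zero_iff i u).1 h')

theorem β_apply (j : W.T₂.Tile) (u : V) : W.β j u = if W.T₂.tile u = j then W.b u else 0 :=
  W.swap.α_apply j u

/-- The map `f ↦ A f` as a linear map. -/
noncomputable def linA : (W.T₁.Tile → ℂ) →ₗ[ℂ] EuclideanSpace ℂ V where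
  toFun := W.liftA
  map_add' f g := by simp [liftA, Matrix.mulVec_add]
  map_smul' r f := by simp [liftA, Matrix.mulVec_smul]

/-- The map `g ↦ B g` as a linear map. -/
noncomputable def linB : (W.T₂.Tile → ℂ) →ₗ[ℂ] EuclideanSpace ℂ V := W.swap.linA

/-- The map `ψ ↦ A† ψ`. -/
noncomputable def coA : EuclideanSpace ℂ V →ₗ[ℂ] (W.T₁.Tile → ℂ) where
  toFun ψ := W.Aᴴ *ᵥ ψ.ofLp
  map_add' f g := by simp [Matrix.mulVec_add]
  map_smul' r f := by simp [Matrix.mulVec_smul]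

/-- The map `ψ ↦ B† ψ`. -/
noncomputable def coB : EuclideanSpace ℂ V →ₗ[ℂ] (W.T₂.Tile → ℂ) := W.swap.coA

theorem liftA_apply (f : W.T₁.Tile → ℂ) (u : V) : W.liftA f u = W.a u * f (W.T₁.tile u) := by
  simp [liftA, A, Matrix.mulVec, dotProduct, α_apply]

theorem liftB_apply (g : W.T₂.Tile → ℂ) (u : V) : W.liftB g u = W.b u * g (W.T₂.tile u) :=
  W.swap.liftA_apply g u

theorem coA_apply (ψ : EuclideanSpace ℂ V) (i : W.T₁.Tile) :
    W.coA ψ i = ∑ u, conj (W.α i u) * ψ u := by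
  simp [coA, A, Matrix.mulVec, dotProduct]

theorem coA_eq_inner (ψ : EuclideanSpace ℂ V) (i : W.T₁.Tile) :
    W.coA ψ i = inner ℂ (W.α i) ψ := by
  simp [coA_apply, PiLp.inner_apply, mul_comm]

/-- Distinct polygons of one tessellation are disjoint, so the unit vectors `|α⟩` are orthonormal.
-/
theorem conjTranspose_A_mul_A : W.Aᴴ * W.A = 1 := by
  ext i j
  have : (W.Aᴴ * W.A) i j = inner ℂ (W.α i) (W.α j) := by
    simp [Matrix.mul_apply, A, PiLp.inner_apply, mul_comm]
  rw [this, Matrix.one_apply]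
  split_ifs with h
  · subst h
    rw [inner_self_eq_norm_sq_to_K, W.norm_α]; simp
  · rw [PiLp.inner_apply]
    refine Finset.sum_eq_zero fun u _ => ?_
    by_cases hu : W.T₁.tile u = i
    · have : W.T₁.tile u ≠ j := fun h' => h (hu.symm.trans h')
      simp [α_apply, this]
    · simp [α_apply, hu]

theorem coA_linA (f : W.T₁.Tile → ℂ) : W.coA (W.linA f) = f := by
  change W.Aᴴ *ᵥ (W.A *ᵥ f) = f
  rw [Matrix.mulVec_mulVec, conjTranspose_A_mul_A, Matrix.one_mulVec]

theorem coB_linB (g : W.T₂.Tile → ℂ) : W.coB (W.linB g) = g := W.swap.coA_linA g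

theorem linA_eq_sum (f : W.T₁.Tile → ℂ) : W.linA f = ∑ i, f i • W.α i := by
  ext u
  change W.liftA f u = _
  simp [liftA_apply, α_apply, mul_comm]

theorem inner_linA (f : W.T₁.Tile → ℂ) (ψ : EuclideanSpace ℂ V) (h : W.coA ψ = 0) :
    inner ℂ (W.linA f) ψ = 0 := by
  rw [linA_eq_sum, sum_inner]
  refine Finset.sum_eq_zero fun i _ => ?_
  rw [inner_smul_left, ← coA_eq_inner, h]; simp

theorem spaceA_eq_range : W.spaceA = LinearMap.range W.linA := by
  ext ψ
  rw [spaceA, Submodule.mem_span_range_iff_exists_fun, LinearMap.mem_range]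
  refine exists_congr fun f => ?_
  rw [linA_eq_sum]

theorem spaceB_eq_range : W.spaceB = LinearMap.range W.linB := W.swap.spaceA_eq_range

theorem mem_spaceA_orthogonal {ψ : EuclideanSpace ℂ V} : ψ ∈ W.spaceAᗮ ↔ W.coA ψ = 0 := by
  constructor
  · intro h
    ext i
    rw [coA_eq_inner]
    exact h _ (Submodule.subset_span ⟨i, rfl⟩)
  · intro h
    rw [spaceA_eq_range]
    rintro _ ⟨f, rfl⟩
    exact W.inner_linA f ψ h

theorem mem_orthogonal_iff {ψ : EuclideanSpace ℂ V} :
    ψ ∈ (W.spaceA ⊔ W.spaceB)ᗮ ↔ W.coA ψ = 0 ∧ W.coB ψ = 0 := by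
  rw [← Submodule.inf_orthogonal, Submodule.mem_inf]
  exact and_congr W.mem_spaceA_orthogonal W.swap.mem_spaceA_orthogonal

theorem mem_sup_iff {ψ : EuclideanSpace ℂ V} :
    ψ ∈ W.spaceA ⊔ W.spaceB ↔ ∃ f g, W.linA f + W.linB g = ψ := by
  rw [spaceA_eq_range, spaceB_eq_range, Submodule.mem_sup]
  simp

/-- The common kernel of `A†` and `B†` is the orthogonal complement of `𝒜 + ℬ`. This is the standard
way below to prove identities between vectors of `𝒜 + ℬ`. -/
theorem eq_zero_of_mem_sup {ψ : EuclideanSpace ℂ V} (h : ψ ∈ W.spaceA ⊔ W.spaceB)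
    (hA : W.coA ψ = 0) (hB : W.coB ψ = 0) : ψ = 0 := by
  have := (Submodule.orthogonal_disjoint (W.spaceA ⊔ W.spaceB)).le_bot
    ⟨h, W.mem_orthogonal_iff.2 ⟨hA, hB⟩⟩
  simpa using this

theorem coA_linB (g : W.T₂.Tile → ℂ) : W.coA (W.linB g) = (W.Aᴴ * W.B) *ᵥ g := by
  rw [← Matrix.mulVec_mulVec]; rfl

theorem coB_linA (f : W.T₁.Tile → ℂ) : W.coB (W.linA f) = (W.Bᴴ * W.A) *ᵥ f := W.swap.coA_linB f

theorem T_mulVec (f : W.T₁.Tile → ℂ) (g : W.T₂.Tile → ℂ) :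
    W.T *ᵥ Sum.elim f g = Sum.elim (W.coA (W.linB g)) (W.coB (W.linA f)) := by
  rw [T, Matrix.fromBlocks_mulVec, coA_linB, coB_linA]
  simp

theorem T_mulVec_eq_smul_iff (f : W.T₁.Tile → ℂ) (g : W.T₂.Tile → ℂ) (μ : ℂ) :
    W.T *ᵥ Sum.elim f g = μ • Sum.elim f g ↔
      W.coA (W.linB g) = μ • f ∧ W.coB (W.linA f) = μ • g := by
  rw [T_mulVec]
  constructor
  · intro h
    exact ⟨funext fun i => congrFun h (Sum.inl i), funext fun i => congrFun h (Sum.inr i)⟩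
  · rintro ⟨h1, h2⟩
    rw [h1, h2]
    ext (i | i) <;> simp

section evolution

variable [DecidableEq V]

theorem toEuclideanLin_exp_hamA (z : ℂ) (ψ : EuclideanSpace ℂ V) :
    Matrix.toEuclideanLin (NormedSpace.exp (z • W.hamA)) ψ =
      Complex.exp (-z) • ψ + (Complex.exp z - Complex.exp (-z)) • W.linA (W.coA ψ) := by
  have hP : IsIdempotentElem (W.A * W.Aᴴ) := by
    unfold IsIdempotentElem
    rw [Matrix.mul_assoc, ← Matrix.mul_assoc W.Aᴴ, conjTranspose_A_mul_A, Matrix.one_mul]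
  rw [hamA, exp_smul_reflection hP]
  have h : W.linA (W.coA ψ) = WithLp.toLp 2 ((W.A * W.Aᴴ) *ᵥ ψ.ofLp) := by
    rw [← Matrix.mulVec_mulVec]; rfl
  rw [h]
  ext u
  simp

theorem U_apply (θ : ℝ) (ψ : EuclideanSpace ℂ V) :
    W.U θ ψ = -Matrix.toEuclideanLin (NormedSpace.exp ((Complex.I * (θ : ℂ)) • W.hamB))
      (Matrix.toEuclideanLin (NormedSpace.exp ((Complex.I * (θ : ℂ)) • W.hamA)) ψ) := by
  rw [U, map_neg, LinearMap.neg_apply]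
  congr 1
  ext u
  simp

end evolution

end StaggeredWalk

namespace StaggeredWalk

variable {V : Type*} [Fintype V] {G : SimpleGraph V} (W : StaggeredWalk G)

/-! ### Intersection of the two spaces and reversibility -/

theorem linA_mem_sup (f : W.T₁.Tile → ℂ) : W.linA f ∈ W.spaceA ⊔ W.spaceB :=
  W.mem_sup_iff.2 ⟨f, 0, by simp⟩

theorem linB_mem_sup (g : W.T₂.Tile → ℂ) : W.linB g ∈ W.spaceA ⊔ W.spaceB :=
  W.mem_sup_iff.2 ⟨0, g, by simp⟩

theorem linA_injective : Function.Injective W.linA :=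
  Function.LeftInverse.injective W.coA_linA

theorem linB_injective : Function.Injective W.linB := W.swap.linA_injective

theorem mem_inf_iff {ψ : EuclideanSpace ℂ V} :
    ψ ∈ W.spaceA ⊓ W.spaceB ↔ ∃ f g, W.linA f = ψ ∧ W.linB g = ψ := by
  rw [spaceA_eq_range, spaceB_eq_range, Submodule.mem_inf]
  simp

/-- Both `A†` and `B†` kill `Af - Bg`. Thus an eigenvector of `T` for the eigenvalue `1` is a point
of `𝒜 ∩ ℬ`. -/
theorem linA_eq_linB_of_coA_coB {f : W.T₁.Tile → ℂ} {g : W.T₂.Tile → ℂ}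
    (h1 : W.coA (W.linB g) = f) (h2 : W.coB (W.linA f) = g) : W.linA f = W.linB g := by
  refine sub_eq_zero.1 (W.eq_zero_of_mem_sup
    (Submodule.sub_mem _ (W.linA_mem_sup f) (W.linB_mem_sup g)) ?_ ?_)
  · rw [map_sub, coA_linA, h1, sub_self]
  · rw [map_sub, coB_linB, h2, sub_self]

theorem linA_eq_linB_iff (f : W.T₁.Tile → ℂ) (g : W.T₂.Tile → ℂ) :
    W.linA f = W.linB g ↔ ∀ u, W.a u * f (W.T₁.tile u) = W.b u * g (W.T₂.tile u) := by
  constructor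
  · intro h u
    have : W.liftA f u = W.liftB g u := congrArg (fun ψ : EuclideanSpace ℂ V => ψ u) h
    rwa [liftA_apply, liftB_apply] at this
  · intro h
    ext u
    change W.liftA f u = W.liftB g u
    rw [liftA_apply, liftB_apply, h]

/-- Detailed balance is the equation `Af = Bg` read at each vertex. It forces `A†Bg = f` and `B†Af =
g`, so the eigenvalue is automatically `1`. -/
theorem isReversibleEigenfunction_elim_iff (f : W.T₁.Tile → ℂ) (g : W.T₂.Tile → ℂ) :
    W.IsReversibleEigenfunction (Sum.elim f g) ↔ W.linA f = W.linB g ∧ W.linA f ≠ 0 := by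
  have key : W.linA f = W.linB g → W.linA f = 0 → f = 0 ∧ g = 0 := by
    intro h h0
    exact ⟨W.linA_injective (by simpa using h0), W.linB_injective (by rw [← h, h0, map_zero])⟩
  constructor
  · rintro ⟨h0, -, h⟩
    have h' := (W.linA_eq_linB_iff f g).2 h
    refine ⟨h', fun h1 => h0 ?_⟩
    obtain ⟨rfl, rfl⟩ := key h' h1
    ext (i | i) <;> rfl
  · rintro ⟨h, h0⟩
    refine ⟨fun h1 => h0 ?_, ⟨1, ?_⟩, (W.linA_eq_linB_iff f g).1 h⟩
    · have : f = 0 := funext fun i => congrFun h1 (Sum.inl i)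
      rw [this, map_zero]
    · rw [T_mulVec_eq_smul_iff, ← h, coA_linA, h, coB_linB]
      simp

theorem IsReversibleEigenfunction.linA_eq_linB {W : StaggeredWalk G}
    {ϖ : W.T₁.Tile ⊕ W.T₂.Tile → ℂ} (h : W.IsReversibleEigenfunction ϖ) :
    W.linA (ϖ ∘ Sum.inl) = W.linB (ϖ ∘ Sum.inr) ∧ W.linA (ϖ ∘ Sum.inl) ≠ 0 := by
  rwa [← isReversibleEigenfunction_elim_iff, Sum.elim_comp_inl_inr]

theorem IsReversibleEigenfunction.T_mulVec {W : StaggeredWalk G}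
    {ϖ : W.T₁.Tile ⊕ W.T₂.Tile → ℂ} (h : W.IsReversibleEigenfunction ϖ) : W.T *ᵥ ϖ = ϖ := by
  obtain ⟨h1, -⟩ := h.linA_eq_linB
  have := (W.T_mulVec_eq_smul_iff (ϖ ∘ Sum.inl) (ϖ ∘ Sum.inr) 1).2
    (by rw [← h1, coA_linA, h1, coB_linB]; simp)
  rwa [Sum.elim_comp_inl_inr, one_smul] at this

theorem reversible_iff_inf_ne_bot : W.Reversible ↔ W.spaceA ⊓ W.spaceB ≠ ⊥ := by
  rw [Submodule.ne_bot_iff]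
  constructor
  · rintro ⟨ϖ, h⟩
    obtain ⟨h1, h2⟩ := h.linA_eq_linB
    exact ⟨_, W.mem_inf_iff.2 ⟨_, _, rfl, h1.symm⟩, h2⟩
  · rintro ⟨ψ, h, h0⟩
    obtain ⟨f, g, rfl, h⟩ := W.mem_inf_iff.1 h
    exact ⟨Sum.elim f g, (W.isReversibleEigenfunction_elim_iff f g).2 ⟨h.symm, h0⟩⟩

/-- As `a` and `b` have no zeros, the zero set of `Af = Bg` is a union of polygons of either
tessellation. Adjacent vertices share a polygon, so a single zero spreads over the connected graph.
-/
theorem linA_eq_zero_of_apply_eq_zero (hG : G.Connected) {f : W.T₁.Tile → ℂ} {g : W.T₂.Tile → ℂ}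
    (h : W.linA f = W.linB g) {u : V} (hu : W.linA f u = 0) : W.linA f = 0 := by
  have hA : ∀ v, W.linA f v = 0 ↔ f (W.T₁.tile v) = 0 := by
    intro v
    change W.liftA f v = 0 ↔ _
    simp [liftA_apply, a_ne_zero]
  have hB : ∀ v, W.linA f v = 0 ↔ g (W.T₂.tile v) = 0 := by
    intro v
    rw [h]
    change W.liftB g v = 0 ↔ _
    simp [liftB_apply, b_ne_zero]
  have step : ∀ v w, G.Adj v w → W.linA f v = 0 → W.linA f w = 0 := by
    intro v w hvw hv
    rcases W.cover v w hvw with h1 | h1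
    · rw [hA] at hv ⊢
      rwa [show W.T₁.tile w = W.T₁.tile v from (Quotient.sound h1).symm]
    · rw [hB] at hv ⊢
      rwa [show W.T₂.tile w = W.T₂.tile v from (Quotient.sound h1).symm]
  have walk : ∀ v w, G.Walk v w → W.linA f v = 0 → W.linA f w = 0 := by
    intro v w p
    induction p with
    | nil => exact id
    | cons hvw _ ih => exact fun hv => ih (step _ _ hvw hv)
  ext w
  obtain ⟨p⟩ := hG.preconnected u w
  exact walk u w p hu

theorem IsReversibleEigenfunction.inf_eq_span {W : StaggeredWalk G} (hG : G.Connected)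
    {ϖ : W.T₁.Tile ⊕ W.T₂.Tile → ℂ} (h : W.IsReversibleEigenfunction ϖ) :
    W.spaceA ⊓ W.spaceB = Submodule.span ℂ {W.linA (ϖ ∘ Sum.inl)} := by
  obtain ⟨h1, h2⟩ := h.linA_eq_linB
  apply le_antisymm
  · intro ψ hψ
    obtain ⟨f, g, rfl, hg⟩ := W.mem_inf_iff.1 hψ
    obtain ⟨u⟩ := hG.nonempty
    have hu : W.linA (ϖ ∘ Sum.inl) u ≠ 0 :=
      fun h0 => h2 (W.linA_eq_zero_of_apply_eq_zero hG h1 h0)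
    rw [Submodule.mem_span_singleton]
    refine ⟨W.linA f u / W.linA (ϖ ∘ Sum.inl) u, ?_⟩
    rw [← map_smul, ← sub_eq_zero, ← map_sub]
    refine W.linA_eq_zero_of_apply_eq_zero hG
      (g := (W.linA f u / W.linA (ϖ ∘ Sum.inl) u) • (ϖ ∘ Sum.inr) - g) ?_ (u := u) ?_
    · rw [map_sub, map_sub, map_smul, map_smul, h1, hg]
    · rw [map_sub, map_smul, PiLp.sub_apply, PiLp.smul_apply, smul_eq_mul, div_mul_cancel₀ _ hu,
        sub_self]
  · rw [Submodule.span_singleton_le_iff_mem]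
    exact W.mem_inf_iff.2 ⟨_, _, rfl, h1.symm⟩

/-- Inclusion–exclusion for dimensions, with `dim 𝒜 = m` and `dim ℬ = n` by injectivity of `A` and
`B`. -/
theorem finrank_orthogonal_add :
    (Module.finrank ℂ ((W.spaceA ⊔ W.spaceB)ᗮ : Submodule ℂ (EuclideanSpace ℂ V)) : ℤ) =
      W.betti - 1 +
        Module.finrank ℂ (W.spaceA ⊓ W.spaceB : Submodule ℂ (EuclideanSpace ℂ V)) := by
  have h1 := (W.spaceA ⊔ W.spaceB).finrank_add_finrank_orthogonal
  have h2 := Submodule.finrank_sup_add_finrank_inf_eq W.spaceA W.spaceB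
  have h3 : Module.finrank ℂ W.spaceA = Fintype.card W.T₁.Tile := by
    rw [spaceA_eq_range, LinearMap.finrank_range_of_inj W.linA_injective, Module.finrank_pi]
  have h4 : Module.finrank ℂ W.spaceB = Fintype.card W.T₂.Tile := by
    rw [spaceB_eq_range, LinearMap.finrank_range_of_inj W.linB_injective, Module.finrank_pi]
  rw [finrank_euclideanSpace] at h1
  rw [betti]
  omega

theorem finrank_orthogonal_of_reversible (hG : G.Connected) (hW : W.Reversible) :
    (Module.finrank ℂ ((W.spaceA ⊔ W.spaceB)ᗮ : Submodule ℂ (EuclideanSpace ℂ V)) : ℤ) =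
      W.betti := by
  obtain ⟨ϖ, h⟩ := hW
  rw [finrank_orthogonal_add, h.inf_eq_span hG, finrank_span_singleton h.linA_eq_linB.2]
  simp

theorem inf_eq_bot (hW : ¬ W.Reversible) : W.spaceA ⊓ W.spaceB = ⊥ :=
  not_not.1 fun h => hW (W.reversible_iff_inf_ne_bot.2 h)

theorem finrank_orthogonal_of_not_reversible (hW : ¬ W.Reversible) :
    (Module.finrank ℂ ((W.spaceA ⊔ W.spaceB)ᗮ : Submodule ℂ (EuclideanSpace ℂ V)) : ℤ) =
      W.betti - 1 := by
  rw [finrank_orthogonal_add, W.inf_eq_bot hW, finrank_bot]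
  simp

/-! ### The spectrum of the discriminant -/

theorem mem_spectrum_T_iff (μ : ℂ) : μ ∈ spectrum ℂ W.T ↔ ∃ f g, (f ≠ 0 ∨ g ≠ 0) ∧
    W.coA (W.linB g) = μ • f ∧ W.coB (W.linA f) = μ • g := by
  rw [← Matrix.spectrum_toLin', ← Module.End.hasEigenvalue_iff_mem_spectrum]
  constructor
  · intro h
    obtain ⟨ϖ, h1, h0⟩ := h.exists_hasEigenvector
    rw [Module.End.mem_eigenspace_iff, Matrix.toLin'_apply] at h1
    rw [← Sum.elim_comp_inl_inr ϖ] at h1 h0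
    refine ⟨ϖ ∘ Sum.inl, ϖ ∘ Sum.inr, ?_, (W.T_mulVec_eq_smul_iff _ _ μ).1 h1⟩
    by_contra! hc
    refine h0 ?_
    rw [hc.1, hc.2]
    ext (i | i) <;> rfl
  · rintro ⟨f, g, h0, h⟩
    refine Module.End.hasEigenvalue_of_hasEigenvector (x := Sum.elim f g) ⟨?_, ?_⟩
    · rw [Module.End.mem_eigenspace_iff, Matrix.toLin'_apply]
      exact (W.T_mulVec_eq_smul_iff _ _ μ).2 h
    · intro hc
      rcases h0 with h0 | h0
      · exact h0 (funext fun i => congrFun hc (Sum.inl i))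
      · exact h0 (funext fun i => congrFun hc (Sum.inr i))

/-- `T` is off-diagonal, so changing the sign of the second component negates the eigenvalue. -/
theorem neg_mem_spectrum_T {μ : ℂ} (h : μ ∈ spectrum ℂ W.T) : -μ ∈ spectrum ℂ W.T := by
  rw [mem_spectrum_T_iff] at h ⊢
  obtain ⟨f, g, h0, h1, h2⟩ := h
  refine ⟨f, -g, by simpa using h0, ?_, ?_⟩
  · rw [map_neg, map_neg, h1, neg_smul]
  · rw [h2, neg_smul, smul_neg, neg_neg]

theorem one_mem_spectrum_T_iff : (1 : ℂ) ∈ spectrum ℂ W.T ↔ W.Reversible := by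
  rw [mem_spectrum_T_iff, reversible_iff_inf_ne_bot, Submodule.ne_bot_iff]
  constructor
  · rintro ⟨f, g, h0, h1, h2⟩
    rw [one_smul] at h1 h2
    have h := W.linA_eq_linB_of_coA_coB h1 h2
    refine ⟨W.linA f, W.mem_inf_iff.2 ⟨f, g, rfl, h.symm⟩, fun hc => ?_⟩
    rcases h0 with h0 | h0
    · exact h0 (W.linA_injective (by simpa using hc))
    · exact h0 (W.linB_injective (by rw [← h, hc, map_zero]))
  · rintro ⟨ψ, h, h0⟩
    obtain ⟨f, g, rfl, hg⟩ := W.mem_inf_iff.1 h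
    refine ⟨f, g, Or.inl fun hf => h0 (by rw [hf, map_zero]), ?_, ?_⟩
    · rw [hg, coA_linA, one_smul]
    · rw [← hg, coB_linB, one_smul]

theorem neg_one_mem_spectrum_T_iff : (-1 : ℂ) ∈ spectrum ℂ W.T ↔ W.Reversible := by
  rw [← one_mem_spectrum_T_iff]
  exact ⟨fun h => by simpa using W.neg_mem_spectrum_T h, W.neg_mem_spectrum_T⟩

theorem inner_linA_eq (f : W.T₁.Tile → ℂ) (ψ : EuclideanSpace ℂ V) :
    inner ℂ (W.linA f) ψ = inner ℂ (W.linA f) (W.linA (W.coA ψ)) := by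
  rw [← sub_eq_zero, ← inner_sub_right]
  exact W.inner_linA f _ (by rw [map_sub, coA_linA, sub_self])

theorem inner_linB_eq (g : W.T₂.Tile → ℂ) (ψ : EuclideanSpace ℂ V) :
    inner ℂ (W.linB g) ψ = inner ℂ (W.linB g) (W.linB (W.coB ψ)) := W.swap.inner_linA_eq g ψ

/-- The real part of `⟨Af, Bg⟩` equals both `μ‖Af‖²` and `μ‖Bg‖²`, hence `‖Af ± Bg‖² = (1 ± μ)(‖Af‖²
+ ‖Bg‖²)`. -/
theorem abs_le_one_of_mem_spectrum_T {μ : ℝ} (h : (μ : ℂ) ∈ spectrum ℂ W.T) : |μ| ≤ 1 := by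
  obtain ⟨f, g, h0, h1, h2⟩ := (W.mem_spectrum_T_iff _).1 h
  have e1 : RCLike.re (inner ℂ (W.linA f) (W.linB g)) = μ * ‖W.linA f‖ ^ 2 := by
    rw [inner_linA_eq, h1, map_smul, inner_smul_right, RCLike.re_eq_complex_re,
      Complex.re_ofReal_mul, ← RCLike.re_eq_complex_re, inner_self_eq_norm_sq]
  have e2 : RCLike.re (inner ℂ (W.linA f) (W.linB g)) = μ * ‖W.linB g‖ ^ 2 := by
    rw [inner_re_symm, inner_linB_eq, h2, map_smul, inner_smul_right, RCLike.re_eq_complex_re,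
      Complex.re_ofReal_mul, ← RCLike.re_eq_complex_re, inner_self_eq_norm_sq]
  have e3 := norm_add_sq (𝕜 := ℂ) (W.linA f) (W.linB g)
  have e4 := norm_sub_sq (𝕜 := ℂ) (W.linA f) (W.linB g)
  have hpos : 0 < ‖W.linA f‖ ^ 2 + ‖W.linB g‖ ^ 2 := by
    rcases h0 with h0 | h0
    · have : W.linA f ≠ 0 := fun hc => h0 (W.linA_injective (by simpa using hc))
      positivity
    · have : W.linB g ≠ 0 := fun hc => h0 (W.linB_injective (by simpa using hc))
      positivity
  rw [abs_le]
  constructor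
  · by_contra! hc
    nlinarith [sq_nonneg ‖W.linA f + W.linB g‖]
  · by_contra! hc
    nlinarith [sq_nonneg ‖W.linA f - W.linB g‖]

end StaggeredWalk

/-! ### Eigenvectors of restricted endomorphisms -/

theorem Module.End.mem_map_eigenspace_restrict {K E : Type*} [Field K] [AddCommGroup E]
    [Module K E] {p : Submodule K E} {f : Module.End K E} (h : ∀ x ∈ p, f x ∈ p) (μ : K) (x : E) :
    x ∈ (Module.End.eigenspace (f.restrict h) μ).map p.subtype ↔ x ∈ p ∧ f x = μ • x := by
  simp only [Submodule.mem_map, Module.End.mem_eigenspace_iff, Submodule.subtype_apply]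
  constructor
  · rintro ⟨y, hy, rfl⟩
    exact ⟨y.2, congrArg Subtype.val hy⟩
  · rintro ⟨hx, hf⟩
    exact ⟨⟨x, hx⟩, Subtype.ext hf, rfl⟩

theorem Module.End.mem_spectrum_restrict_iff {K E : Type*} [Field K] [AddCommGroup E]
    [Module K E] [FiniteDimensional K E] {p : Submodule K E} {f : Module.End K E}
    (h : ∀ x ∈ p, f x ∈ p) (μ : K) :
    μ ∈ spectrum K (f.restrict h) ↔ ∃ x ∈ p, x ≠ 0 ∧ f x = μ • x := by
  rw [← Module.End.hasEigenvalue_iff_mem_spectrum]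
  constructor
  · intro hμ
    obtain ⟨x, hx, h0⟩ := hμ.exists_hasEigenvector
    rw [Module.End.mem_eigenspace_iff] at hx
    exact ⟨x, x.2, by simpa using h0, congrArg Subtype.val hx⟩
  · rintro ⟨x, hx, h0, hf⟩
    refine Module.End.hasEigenvalue_of_hasEigenvector (x := ⟨x, hx⟩)
      ⟨Module.End.mem_eigenspace_iff.2 (Subtype.ext hf), fun hc => h0 (congrArg Subtype.val hc)⟩

/-! ### The phases -/

theorem exp_two_I_phiMinus (θ : ℝ) :
    Complex.exp (2 * Complex.I * phiMinus θ) = -Complex.exp (2 * Complex.I * θ) := by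
  have : 2 * Complex.I * (phiMinus θ : ℂ) = 2 * Complex.I * θ + Real.pi * Complex.I := by
    rw [phiMinus]; push_cast; ring
  rw [this, Complex.exp_add, Complex.exp_pi_mul_I]
  ring

theorem cos_phase {θ μ : ℝ} (hμ : |μ| ≤ 1) : Real.cos (phase θ μ) = μ * Real.sin θ := by
  have h : |μ * Real.sin θ| ≤ 1 := by
    rw [abs_mul]
    exact mul_le_one₀ hμ (abs_nonneg _) (Real.abs_sin_le_one θ)
  rw [abs_le] at h
  unfold phase
  split_ifs
  · exact Real.cos_arccos h.1 h.2
  · rw [Real.cos_neg, Real.cos_arccos h.1 h.2]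

theorem arccos_sin_of_le {θ : ℝ} (h0 : 0 < θ) (h : θ ≤ Real.pi / 2) :
    Real.arccos (Real.sin θ) = Real.pi / 2 - θ := by
  rw [← Real.cos_pi_div_two_sub, Real.arccos_cos (by linarith) (by linarith [Real.pi_pos])]

theorem phase_one {θ : ℝ} (hθ : θ ∈ Set.Ioo 0 Real.pi) : phase θ 1 = Real.pi / 2 - θ := by
  unfold phase
  rw [one_mul]
  split_ifs with h
  · exact arccos_sin_of_le hθ.1 h
  · rw [← Real.sin_pi_sub, arccos_sin_of_le (by linarith [hθ.2]) (by linarith)]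
    ring

theorem exp_phase_one {θ : ℝ} (hθ : θ ∈ Set.Ioo 0 Real.pi) :
    Complex.exp (2 * Complex.I * phase θ 1) = -Complex.exp (-2 * Complex.I * θ) := by
  have : 2 * Complex.I * (phase θ 1 : ℂ) = -2 * Complex.I * θ + Real.pi * Complex.I := by
    rw [phase_one hθ]; push_cast; ring
  rw [this, Complex.exp_add, Complex.exp_pi_mul_I]
  ring

theorem exp_two_I_pi_sub (x : ℝ) :
    Complex.exp (2 * Complex.I * ((Real.pi - x : ℝ) : ℂ)) = Complex.exp (-(2 * Complex.I * x)) := by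
  have : 2 * Complex.I * ((Real.pi - x : ℝ) : ℂ) =
      -(2 * Complex.I * x) + 2 * Real.pi * Complex.I := by
    push_cast; ring
  rw [this, Complex.exp_add, Complex.exp_two_pi_mul_I, mul_one]

/-- `arccos(-x) = π - arccos x`, and doubling the angle removes the `π`. -/
theorem exp_phase_neg (θ μ : ℝ) :
    Complex.exp (2 * Complex.I * phase θ (-μ)) = Complex.exp (-(2 * Complex.I * phase θ μ)) := by
  unfold phase
  split_ifs
  · rw [neg_mul, Real.arccos_neg, exp_two_I_pi_sub]
  · have h := exp_two_I_pi_sub (Real.arccos (μ * Real.sin θ))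
    rw [neg_mul, Real.arccos_neg, Complex.ofReal_neg, mul_neg, Complex.exp_neg, h,
      Complex.ofReal_neg, mul_neg, ← Complex.exp_neg]

theorem exp_phase_neg_one {θ : ℝ} (hθ : θ ∈ Set.Ioo 0 Real.pi) :
    Complex.exp (2 * Complex.I * phase θ (-1)) = -Complex.exp (2 * Complex.I * θ) := by
  rw [exp_phase_neg, Complex.exp_neg, exp_phase_one hθ, inv_neg, ← Complex.exp_neg]
  ring_nf

theorem exp_two_I_arccos_of_lt {θ : ℝ} (h : Real.pi / 2 < θ) (μ : ℝ) :
    Complex.exp (2 * Complex.I * Real.arccos (μ * Real.sin θ)) =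
      Complex.exp (2 * Complex.I * phase θ (-μ)) := by
  rw [exp_phase_neg]
  unfold phase
  rw [if_neg (not_le.2 h)]
  push_cast
  ring_nf

/-- `l` determines `φ` only modulo `π`, so `φ` can be moved into the branch interval `[0, π]` or
`[-π, 0]`, where `phase` inverts the cosine. -/
theorem exists_exp_two_I_eq {l : ℂ} (hl : ‖l‖ = 1) (θ : ℝ) :
    ∃ φ : ℝ, l = Complex.exp (2 * Complex.I * φ) ∧
      (Real.sin θ ≠ 0 → phase θ (Real.cos φ / Real.sin θ) = φ) := by
  have hl' : l = Complex.exp (2 * Complex.I * ((l.arg / 2 : ℝ) : ℂ)) := by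
    conv_lhs => rw [← Complex.norm_mul_exp_arg_mul_I l, hl]
    push_cast; ring_nf
  have key : ∃ φ : ℝ, l = Complex.exp (2 * Complex.I * φ) ∧ 0 ≤ φ ∧ φ ≤ Real.pi := by
    have h1 := Complex.neg_pi_lt_arg l
    have h2 := Complex.arg_le_pi l
    rcases le_or_gt 0 l.arg with h | h
    · exact ⟨l.arg / 2, hl', by linarith, by linarith [Real.pi_pos]⟩
    · refine ⟨l.arg / 2 + Real.pi, ?_, by linarith, by linarith [Real.pi_pos]⟩
      rw [show 2 * Complex.I * ((l.arg / 2 + Real.pi : ℝ) : ℂ) =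
        2 * Complex.I * ((l.arg / 2 : ℝ) : ℂ) + 2 * Real.pi * Complex.I by push_cast; ring,
        Complex.exp_add, Complex.exp_two_pi_mul_I, mul_one, ← hl']
  obtain ⟨φ, h1, h2, h3⟩ := key
  by_cases hθ : θ ≤ Real.pi / 2
  · refine ⟨φ, h1, fun hs => ?_⟩
    rw [phase, if_pos hθ, div_mul_cancel₀ _ hs, Real.arccos_cos h2 h3]
  · refine ⟨φ - Real.pi, ?_, fun hs => ?_⟩
    · rw [h1, show 2 * Complex.I * (φ : ℂ) =
        2 * Complex.I * ((φ - Real.pi : ℝ) : ℂ) + 2 * Real.pi * Complex.I by push_cast; ring,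
        Complex.exp_add, Complex.exp_two_pi_mul_I, mul_one]
    · rw [phase, if_neg hθ, div_mul_cancel₀ _ hs, ← Real.cos_neg,
        Real.arccos_cos (by linarith) (by linarith)]
      ring

/-- Away from `θ = π/2` the eigenvalue attached to `μ = 1` is not `1`, as `eq_zero_of_U_apply_eq`
requires. -/
theorem exp_neg_two_I_ne_neg_one {θ : ℝ} (hθ : θ ∈ Set.Ioo 0 Real.pi) (h : θ ≠ Real.pi / 2) :
    -Complex.exp (-2 * Complex.I * θ) ≠ 1 := by
  intro hc
  apply h
  have h1 : Complex.exp (-2 * Complex.I * θ) = -1 := by rw [← neg_eq_iff_eq_neg]; exact hc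
  have h2 : Real.cos (2 * θ) = -1 := by
    have h3 := congrArg Complex.re h1
    rw [show -2 * Complex.I * (θ : ℂ) = ((-(2 * θ) : ℝ) : ℂ) * Complex.I by push_cast; ring,
      Complex.exp_ofReal_mul_I_re, Real.cos_neg] at h3
    simpa using h3
  rw [Real.cos_two_mul] at h2
  have h3 : Real.cos θ = 0 := by nlinarith
  rw [← Real.cos_pi_div_two] at h3
  exact Real.injOn_cos ⟨hθ.1.le, hθ.2.le⟩ ⟨by linarith [Real.pi_pos], by linarith [Real.pi_pos]⟩ h3

theorem neg_exp_pi_div_two : -Complex.exp (2 * Complex.I * ((Real.pi / 2 : ℝ) : ℂ)) = 1 := by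
  rw [show 2 * Complex.I * ((Real.pi / 2 : ℝ) : ℂ) = Real.pi * Complex.I by push_cast; ring,
    Complex.exp_pi_mul_I, neg_neg]

theorem neg_exp_neg_pi_div_two :
    -Complex.exp (-2 * Complex.I * ((Real.pi / 2 : ℝ) : ℂ)) = 1 := by
  rw [show -2 * Complex.I * ((Real.pi / 2 : ℝ) : ℂ) = -(Real.pi * Complex.I) by push_cast; ring,
    Complex.exp_neg, Complex.exp_pi_mul_I]
  norm_num

/-! ### The evolution operator and its eigenvalue equation -/

namespace StaggeredWalk

variable {V : Type*} [Fintype V] {G : SimpleGraph V} (W : StaggeredWalk G)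

/-- The operator `e^{z H_A} = e^{-z} + (e^z - e^{-z}) A A†`. -/
noncomputable def evoA (z : ℂ) : Module.End ℂ (EuclideanSpace ℂ V) :=
  Complex.exp (-z) • LinearMap.id + (Complex.exp z - Complex.exp (-z)) • W.linA ∘ₗ W.coA

/-- The operator `e^{z H_B} = e^{-z} + (e^z - e^{-z}) B B†`. -/
noncomputable def evoB (z : ℂ) : Module.End ℂ (EuclideanSpace ℂ V) := W.swap.evoA z

theorem evoA_apply (z : ℂ) (ψ : EuclideanSpace ℂ V) :
    W.evoA z ψ =
      Complex.exp (-z) • ψ + (Complex.exp z - Complex.exp (-z)) • W.linA (W.coA ψ) := rfl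

theorem evoB_apply (z : ℂ) (ψ : EuclideanSpace ℂ V) :
    W.evoB z ψ =
      Complex.exp (-z) • ψ + (Complex.exp z - Complex.exp (-z)) • W.linB (W.coB ψ) := rfl

theorem evoA_neg_evoA (z : ℂ) (ψ : EuclideanSpace ℂ V) : W.evoA (-z) (W.evoA z ψ) = ψ := by
  have h : Complex.exp z * Complex.exp (-z) = 1 := by rw [← Complex.exp_add]; simp
  simp only [evoA_apply, map_add, map_smul, coA_linA, neg_neg]
  linear_combination (norm := module) h • ψ

theorem evoB_neg_evoB (z : ℂ) (ψ : EuclideanSpace ℂ V) : W.evoB (-z) (W.evoB z ψ) = ψ :=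
  W.swap.evoA_neg_evoA z ψ

/-- The operator is `e^{iθ}` on `𝒜` and `e^{-iθ}` on `𝒜ᗮ`, so Pythagoras applies. -/
theorem norm_evoA (θ : ℝ) (ψ : EuclideanSpace ℂ V) : ‖W.evoA (Complex.I * θ) ψ‖ = ‖ψ‖ := by
  have h0 : W.coA (ψ - W.linA (W.coA ψ)) = 0 := by rw [map_sub, coA_linA, sub_self]
  have h1 : inner ℂ (W.linA (W.coA ψ)) (ψ - W.linA (W.coA ψ)) = 0 := W.inner_linA _ _ h0
  have h2 : W.evoA (Complex.I * θ) ψ = Complex.exp (Complex.I * θ) • W.linA (W.coA ψ) +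
      Complex.exp (-(Complex.I * θ)) • (ψ - W.linA (W.coA ψ)) := by
    rw [evoA_apply]; module
  have h3 : ψ = W.linA (W.coA ψ) + (ψ - W.linA (W.coA ψ)) := by abel
  have n1 : ‖Complex.exp (Complex.I * θ)‖ = 1 := by
    rw [mul_comm]; exact Complex.norm_exp_ofReal_mul_I θ
  have n2 : ‖Complex.exp (-(Complex.I * θ))‖ = 1 := by rw [Complex.exp_neg, norm_inv, n1, inv_one]
  have h4 := norm_add_sq_eq_norm_sq_add_norm_sq_of_inner_eq_zero _ _ h1
  have h5 : inner ℂ (Complex.exp (Complex.I * θ) • W.linA (W.coA ψ))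
      (Complex.exp (-(Complex.I * θ)) • (ψ - W.linA (W.coA ψ))) = 0 := by
    rw [inner_smul_left, inner_smul_right, h1]; simp
  have h6 := norm_add_sq_eq_norm_sq_add_norm_sq_of_inner_eq_zero _ _ h5
  rw [← h2, norm_smul, norm_smul, n1, n2, one_mul, one_mul, ← h4, ← h3] at h6
  nlinarith [norm_nonneg ψ, norm_nonneg (W.evoA (Complex.I * θ) ψ)]

theorem norm_evoB (θ : ℝ) (ψ : EuclideanSpace ℂ V) : ‖W.evoB (Complex.I * θ) ψ‖ = ‖ψ‖ :=
  W.swap.norm_evoA θ ψ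

theorem evoA_mem_sup (z : ℂ) {ψ : EuclideanSpace ℂ V} (h : ψ ∈ W.spaceA ⊔ W.spaceB) :
    W.evoA z ψ ∈ W.spaceA ⊔ W.spaceB :=
  Submodule.add_mem _ (Submodule.smul_mem _ _ h) (Submodule.smul_mem _ _ (W.linA_mem_sup _))

theorem evoB_mem_sup (z : ℂ) {ψ : EuclideanSpace ℂ V} (h : ψ ∈ W.spaceA ⊔ W.spaceB) :
    W.evoB z ψ ∈ W.spaceA ⊔ W.spaceB :=
  Submodule.add_mem _ (Submodule.smul_mem _ _ h) (Submodule.smul_mem _ _ (W.linB_mem_sup _))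

variable [DecidableEq V] {θ : ℝ}

theorem U_eq_evo (θ : ℝ) (ψ : EuclideanSpace ℂ V) :
    W.U θ ψ = -W.evoB (Complex.I * θ) (W.evoA (Complex.I * θ) ψ) := by
  rw [U_apply, toEuclideanLin_exp_hamA]
  exact congrArg Neg.neg (W.swap.toEuclideanLin_exp_hamA _ _)

theorem U_mem_sup (θ : ℝ) : ∀ ψ ∈ W.spaceA ⊔ W.spaceB, W.U θ ψ ∈ W.spaceA ⊔ W.spaceB := by
  intro ψ h
  rw [U_eq_evo]
  exact Submodule.neg_mem _ (W.evoB_mem_sup _ (W.evoA_mem_sup _ h))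

theorem U_apply_of_mem_orthogonal (θ : ℝ) {ψ : EuclideanSpace ℂ V}
    (h : ψ ∈ (W.spaceA ⊔ W.spaceB)ᗮ) : W.U θ ψ = (-Complex.exp (-2 * Complex.I * θ)) • ψ := by
  obtain ⟨h1, h2⟩ := W.mem_orthogonal_iff.1 h
  rw [U_eq_evo, evoA_apply, h1, map_zero, smul_zero, add_zero, map_smul, evoB_apply, h2, map_zero,
    smul_zero, add_zero, smul_smul, ← Complex.exp_add, neg_smul]
  congr 3
  ring

theorem U_mem_orthogonal (θ : ℝ) :
    ∀ ψ ∈ (W.spaceA ⊔ W.spaceB)ᗮ, W.U θ ψ ∈ (W.spaceA ⊔ W.spaceB)ᗮ := by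
  intro ψ h
  rw [W.U_apply_of_mem_orthogonal θ h]
  exact Submodule.smul_mem _ _ h

theorem map_eigenspace_orthogonal (θ : ℝ)
    (hperp : ∀ ψ ∈ (W.spaceA ⊔ W.spaceB)ᗮ, W.U θ ψ ∈ (W.spaceA ⊔ W.spaceB)ᗮ)
    :
    (Module.End.eigenspace ((W.U θ).restrict hperp) (-Complex.exp (-2 * Complex.I * θ))).map
      ((W.spaceA ⊔ W.spaceB)ᗮ : Submodule ℂ (EuclideanSpace ℂ V)).subtype =
      (W.spaceA ⊔ W.spaceB)ᗮ := by
  ext ψ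
  rw [Module.End.mem_map_eigenspace_restrict]
  exact ⟨And.left, fun h => ⟨h, W.U_apply_of_mem_orthogonal θ h⟩⟩

theorem spectrum_orthogonal_eq_empty (θ : ℝ)
    (hperp : ∀ ψ ∈ (W.spaceA ⊔ W.spaceB)ᗮ, W.U θ ψ ∈ (W.spaceA ⊔ W.spaceB)ᗮ)
    (h : (W.spaceA ⊔ W.spaceB)ᗮ = ⊥) :
    spectrum ℂ ((W.U θ).restrict hperp) = ∅ := by
  ext l
  rw [Module.End.mem_spectrum_restrict_iff, h]
  simp

theorem spectrum_orthogonal_eq_singleton (θ : ℝ)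
    (hperp : ∀ ψ ∈ (W.spaceA ⊔ W.spaceB)ᗮ, W.U θ ψ ∈ (W.spaceA ⊔ W.spaceB)ᗮ)
    (h : (W.spaceA ⊔ W.spaceB)ᗮ ≠ ⊥) :
    spectrum ℂ ((W.U θ).restrict hperp) = {-Complex.exp (-2 * Complex.I * θ)} := by
  ext l
  rw [Module.End.mem_spectrum_restrict_iff, Set.mem_singleton_iff]
  constructor
  · rintro ⟨ψ, hψ, h0, h1⟩
    rw [W.U_apply_of_mem_orthogonal θ hψ] at h1
    exact (smul_left_injective ℂ h0 h1).symm
  · rintro rfl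
    obtain ⟨ψ, hψ, h0⟩ := (Submodule.ne_bot_iff _).1 h
    exact ⟨ψ, hψ, h0, W.U_apply_of_mem_orthogonal θ hψ⟩

theorem norm_eq_one_of_U_apply_eq {ψ : EuclideanSpace ℂ V} (h0 : ψ ≠ 0) {l : ℂ}
    (h : W.U θ ψ = l • ψ) : ‖l‖ = 1 := by
  have h1 : ‖W.U θ ψ‖ = ‖ψ‖ := by rw [U_eq_evo, norm_neg, norm_evoB, norm_evoA]
  rw [h, norm_smul] at h1
  exact mul_right_cancel₀ (norm_ne_zero_iff.2 h0) (h1.trans (one_mul _).symm)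

/-- Inverting `e^{iθH_B}` avoids the product of the two projections and leaves an equation linear in
each. -/
theorem U_apply_eq_smul_iff (ψ : EuclideanSpace ℂ V) (l : ℂ) :
    W.U θ ψ = l • ψ ↔
      -(Complex.exp (-(Complex.I * θ)) + l * Complex.exp (Complex.I * θ)) • ψ =
        (Complex.exp (Complex.I * θ) - Complex.exp (-(Complex.I * θ))) •
          (W.linA (W.coA ψ) - l • W.linB (W.coB ψ)) := by
  have h1 : W.U θ ψ = l • ψ ↔
      -W.evoA (Complex.I * θ) ψ = l • W.evoB (-(Complex.I * θ)) ψ := by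
    rw [U_eq_evo, ← map_neg]
    constructor
    · intro h
      have := congrArg (W.evoB (-(Complex.I * θ))) h
      rwa [evoB_neg_evoB, map_smul] at this
    · intro h
      rw [h, map_smul]
      congr 1
      simpa using W.evoB_neg_evoB (-(Complex.I * θ)) ψ
  rw [h1, evoA_apply, evoB_apply, neg_neg]
  constructor
  · intro h
    linear_combination (norm := module) h
  · intro h
    linear_combination (norm := module) h

theorem exp_sub_exp_neg_ne_zero (hθ : θ ∈ Set.Ioo 0 Real.pi) :
    Complex.exp (Complex.I * θ) - Complex.exp (-(Complex.I * θ)) ≠ 0 := by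
  intro h
  have h1 := congrArg Complex.im h
  rw [mul_comm, ← neg_mul, ← Complex.ofReal_neg, Complex.sub_im, Complex.exp_ofReal_mul_I_im,
    Complex.exp_ofReal_mul_I_im, Real.sin_neg] at h1
  have := Real.sin_pos_of_mem_Ioo hθ
  simp at h1
  linarith

/-- The scalar identities behind the eigenvectors `A f + i e^{i(θ+φ)} B g`. -/
theorem lift_identities {μ φ : ℝ} (h : Real.cos φ = μ * Real.sin θ) :
    let s := Complex.exp (Complex.I * θ) - Complex.exp (-(Complex.I * θ))
    let l := Complex.exp (2 * Complex.I * φ)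
    let d := Complex.exp (-(Complex.I * θ)) + l * Complex.exp (Complex.I * θ)
    let η := Complex.I * Complex.exp (Complex.I * ((θ : ℂ) + φ))
    s * (1 + η * μ) = -d ∧ d * η = s * l * (μ + η) := by
  intro s l d η
  -- Since `s = 2i sin θ`, the hypothesis turns `sμ` into `2i cos φ`. This removes `μ`, and both
  -- claims become rational identities in `e^{iθ}` and `e^{iφ}`.
  have hs : s * μ = Complex.I * (Complex.exp (Complex.I * φ) + (Complex.exp (Complex.I * φ))⁻¹) := by
    have h1 : (Complex.exp (Complex.I * φ) + Complex.exp (-(Complex.I * φ))) = 2 * Complex.cos φ := by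
      rw [Complex.cos]; ring_nf
    have h2 : s = 2 * Complex.I * Complex.sin θ := by
      simp only [s, Complex.sin]
      ring_nf
      rw [Complex.I_sq]; ring
    rw [← Complex.exp_neg, h1, h2, ← Complex.ofReal_cos, h]
    push_cast; ring
  have hl : l = Complex.exp (Complex.I * φ) ^ 2 := by
    rw [← Complex.exp_nat_mul]; simp only [l]; push_cast; ring_nf
  have hη : η = Complex.I * (Complex.exp (Complex.I * θ) * Complex.exp (Complex.I * φ)) := by
    rw [← Complex.exp_add, ← mul_add]
  have hd : d = (Complex.exp (Complex.I * θ))⁻¹ + l * Complex.exp (Complex.I * θ) := by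
    rw [← Complex.exp_neg]
  have hs' : s = Complex.exp (Complex.I * θ) - (Complex.exp (Complex.I * θ))⁻¹ := by
    rw [← Complex.exp_neg]
  have hy : Complex.exp (Complex.I * θ) ≠ 0 := Complex.exp_ne_zero _
  have hw : Complex.exp (Complex.I * φ) ≠ 0 := Complex.exp_ne_zero _
  have e1 : s * (1 + η * μ) = s + η * (s * μ) := by ring
  have e2 : s * l * (μ + η) = l * (s * μ + s * η) := by ring
  rw [e1, e2, hs, hη, hs', hd, hl]
  generalize Complex.exp (Complex.I * θ) = y at *
  generalize Complex.exp (Complex.I * φ) = w at *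
  have hI : Complex.I ^ 2 = -1 := Complex.I_sq
  constructor
  · field_simp
    linear_combination (y ^ 2 + y ^ 2 * w ^ 2) * hI
  · field_simp
    ring

end StaggeredWalk

namespace StaggeredWalk

variable {V : Type*} [Fintype V] {G : SimpleGraph V} (W : StaggeredWalk G)
variable [DecidableEq V] {θ : ℝ}

/-! ### Eigenvectors in the sum of the two spaces -/

/-- For `ψ = Af + ηBg` one finds `A†ψ = (1 + ημ)f` and `B†ψ = (μ + η)g`. The `lift_identities` match
the coefficients of `Af` and `Bg` in the eigenvalue equation. -/
theorem U_apply_lift {μ φ : ℝ} (h : Real.cos φ = μ * Real.sin θ) {f : W.T₁.Tile → ℂ}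
    {g : W.T₂.Tile → ℂ} (h1 : W.coA (W.linB g) = (μ : ℂ) • f)
    (h2 : W.coB (W.linA f) = (μ : ℂ) • g) :
    W.U θ (W.linA f + (Complex.I * Complex.exp (Complex.I * ((θ : ℂ) + φ))) • W.linB g) =
      Complex.exp (2 * Complex.I * φ) •
        (W.linA f + (Complex.I * Complex.exp (Complex.I * ((θ : ℂ) + φ))) • W.linB g) := by
  rw [U_apply_eq_smul_iff]
  obtain ⟨e1, e2⟩ := lift_identities h
  simp only [map_add, map_smul, coA_linA, coB_linB, h1, h2]
  linear_combination (norm := module) (-e1) • W.linA f - e2 • W.linB g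

theorem exists_lift_of_U_apply {μ φ : ℝ} (h : Real.cos φ = μ * Real.sin θ)
    (hd : Complex.exp (2 * Complex.I * φ) ≠ -Complex.exp (-2 * Complex.I * θ))
    {ψ : EuclideanSpace ℂ V} (hψ : W.U θ ψ = Complex.exp (2 * Complex.I * φ) • ψ) :
    ∃ f g, W.coA (W.linB g) = (μ : ℂ) • f ∧ W.coB (W.linA f) = (μ : ℂ) • g ∧
      ψ = W.linA f + (Complex.I * Complex.exp (Complex.I * ((θ : ℂ) + φ))) • W.linB g := by
  rw [U_apply_eq_smul_iff] at hψ
  have hd' : Complex.exp (-(Complex.I * θ)) +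
      Complex.exp (2 * Complex.I * φ) * Complex.exp (Complex.I * θ) ≠ 0 := by
    intro hc
    apply hd
    have h1 : Complex.exp (-2 * Complex.I * θ) =
        Complex.exp (-(Complex.I * θ)) * Complex.exp (-(Complex.I * θ)) := by
      rw [← Complex.exp_add]; ring_nf
    have h2 : Complex.exp (Complex.I * θ) * Complex.exp (-(Complex.I * θ)) = 1 := by
      rw [← Complex.exp_add]; simp
    rw [h1]
    linear_combination Complex.exp (-(Complex.I * θ)) * hc -
      Complex.exp (2 * Complex.I * φ) * h2
  obtain ⟨e1, e2⟩ := lift_identities h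
  have hη : Complex.I * Complex.exp (Complex.I * ((θ : ℂ) + φ)) ≠ 0 :=
    mul_ne_zero Complex.I_ne_zero (Complex.exp_ne_zero _)
  generalize Complex.exp (Complex.I * θ) - Complex.exp (-(Complex.I * θ)) = s at *
  generalize Complex.exp (-(Complex.I * θ)) +
      Complex.exp (2 * Complex.I * φ) * Complex.exp (Complex.I * θ) = d at *
  generalize Complex.I * Complex.exp (Complex.I * ((θ : ℂ) + φ)) = η at *
  generalize Complex.exp (2 * Complex.I * φ) = l at *
  have hA := congrArg W.coA hψ
  have hB := congrArg W.coB hψ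
  simp only [map_smul, map_sub, coA_linA, coB_linB] at hA hB
  -- Solving `-dψ = s(AA†ψ - l BB†ψ)` for `ψ` dictates `f` and `g`; applying `A†` and `B†` to the
  -- same equation shows that they form an eigenvector of `T`.
  refine ⟨(-(s / d)) • W.coA ψ, (s * l / (d * η)) • W.coB ψ, ?_, ?_, ?_⟩
  · rw [map_smul, map_smul]
    have e3 : (1 / (d * η)) * (s + d) = -(μ * (s / d)) := by
      field_simp
      linear_combination e1
    linear_combination (norm := module) (1 / (d * η)) • hA + e3 • W.coA ψ
  · rw [map_smul, map_smul]
    have e3 : (1 / d) * (d - s * l) = μ * (s * l / (d * η)) := by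
      field_simp
      linear_combination e2
    linear_combination (norm := module) (1 / d) • hB + e3 • W.coB ψ
  · rw [map_smul, map_smul]
    have e3 : (1 / d) * d = 1 := by field_simp
    have e5 : η * (s * l / (d * η)) = (1 / d) * (s * l) := by field_simp
    linear_combination (norm := module) (-(1 / d)) • hψ - e3 • ψ - e5 • W.linB (W.coB ψ)

/-- Here `d = 0`, so `AA†ψ = l BB†ψ`. This vector is orthogonal to `ψ - AA†ψ`, whose image under
`B†` is `(1 - l)B†ψ`. Hence `(1 - l)‖BB†ψ‖² = 0`, and both projections of `ψ` vanish. -/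
theorem eq_zero_of_U_apply_eq (hθ : θ ∈ Set.Ioo 0 Real.pi) {ψ : EuclideanSpace ℂ V}
    (hψ : ψ ∈ W.spaceA ⊔ W.spaceB) (h1 : -Complex.exp (-2 * Complex.I * θ) ≠ 1)
    (h : W.U θ ψ = (-Complex.exp (-2 * Complex.I * θ)) • ψ) : ψ = 0 := by
  rw [U_apply_eq_smul_iff] at h
  have hs := exp_sub_exp_neg_ne_zero hθ
  have hd : Complex.exp (-(Complex.I * θ)) +
      -Complex.exp (-2 * Complex.I * θ) * Complex.exp (Complex.I * θ) = 0 := by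
    rw [neg_mul, ← Complex.exp_add]; ring_nf
  rw [hd, neg_zero, zero_smul, eq_comm, smul_eq_zero, or_iff_right hs, sub_eq_zero] at h
  have hl : -Complex.exp (-2 * Complex.I * θ) ≠ 0 := neg_ne_zero.2 (Complex.exp_ne_zero _)
  generalize -Complex.exp (-2 * Complex.I * θ) = l at *
  have hw : W.coA (ψ - W.linA (W.coA ψ)) = 0 := by rw [map_sub, coA_linA, sub_self]
  have hw' : W.coB (ψ - W.linA (W.coA ψ)) = (1 - l) • W.coB ψ := by
    rw [h, map_sub, map_smul, coB_linB, sub_smul, one_smul]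
  have h2 : inner ℂ (W.linA (W.coA ψ)) (ψ - W.linA (W.coA ψ)) = 0 := W.inner_linA _ _ hw
  have h5 : conj l * inner ℂ (W.linB (W.coB ψ)) (ψ - W.linA (W.coA ψ)) = 0 := by
    rw [← inner_smul_left, ← h, h2]
  rw [inner_linB_eq, hw', map_smul, inner_smul_right] at h5
  have hB : W.linB (W.coB ψ) = 0 := by
    rcases mul_eq_zero.1 h5 with h3 | h3
    · exact absurd ((map_eq_zero _).1 h3) hl
    · rcases mul_eq_zero.1 h3 with h4 | h4
      · exact absurd (sub_eq_zero.1 h4).symm h1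
      · exact inner_self_eq_zero.1 h4
  rw [hB, smul_zero] at h
  refine W.eq_zero_of_mem_sup hψ ?_ ?_
  · rw [← W.coA_linA (W.coA ψ), h, map_zero]
  · rw [← W.coB_linB (W.coB ψ), hB, map_zero]

theorem U_apply_of_mem_inf {ψ : EuclideanSpace ℂ V} (h : ψ ∈ W.spaceA ⊓ W.spaceB) :
    W.U θ ψ = (-Complex.exp (2 * Complex.I * θ)) • ψ := by
  obtain ⟨f, g, hf, hg⟩ := W.mem_inf_iff.1 h
  have h1 : W.linA (W.coA ψ) = ψ := by rw [← hf, coA_linA]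
  have h2 : W.linB (W.coB ψ) = ψ := by rw [← hg, coB_linB]
  have h3 : Complex.exp (2 * Complex.I * θ) =
      Complex.exp (Complex.I * θ) * Complex.exp (Complex.I * θ) := by
    rw [← Complex.exp_add]; ring_nf
  rw [U_eq_evo, evoA_apply, h1, map_add, map_smul, map_smul, evoB_apply, h2, h3]
  module

/-- For this eigenvalue, applying `A†` and `B†` to the eigenvalue equation yields `A†BB†ψ = A†ψ` and
`B†AA†ψ = B†ψ`. So `AA†ψ = BB†ψ`, and `ψ` agrees with this vector. No exception is needed at `θ =
π/2`. -/
theorem mem_inf_of_U_apply_eq (hθ : θ ∈ Set.Ioo 0 Real.pi) {ψ : EuclideanSpace ℂ V}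
    (hψ : ψ ∈ W.spaceA ⊔ W.spaceB) (h : W.U θ ψ = (-Complex.exp (2 * Complex.I * θ)) • ψ) :
    ψ ∈ W.spaceA ⊓ W.spaceB := by
  rw [U_apply_eq_smul_iff] at h
  have hs := exp_sub_exp_neg_ne_zero hθ
  have h3 : Complex.exp (2 * Complex.I * θ) =
      Complex.exp (Complex.I * θ) * Complex.exp (Complex.I * θ) := by
    rw [← Complex.exp_add]; ring_nf
  have h4 : Complex.exp (Complex.I * θ) * Complex.exp (-(Complex.I * θ)) = 1 := by
    rw [← Complex.exp_add]; simp
  rw [h3] at h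
  have hy := Complex.exp_ne_zero (Complex.I * θ)
  generalize Complex.exp (Complex.I * θ) = y at *
  generalize Complex.exp (-(Complex.I * θ)) = x at *
  have hA := congrArg W.coA h
  have hB := congrArg W.coB h
  simp only [map_smul, map_sub, coA_linA, coB_linB] at hA hB
  have hA' : W.coA (W.linB (W.coB ψ)) = W.coA ψ := by
    have hk : y * y * (y - x) ≠ 0 := mul_ne_zero (mul_ne_zero hy hy) hs
    apply smul_right_injective _ hk
    change (y * y * (y - x)) • _ = (y * y * (y - x)) • _
    have e : y * y * (y - x) = y * y * y - y := by linear_combination (-y) * h4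
    linear_combination (norm := module) -hA - e • W.coA ψ
  have hB' : W.coB (W.linA (W.coA ψ)) = W.coB ψ := by
    apply smul_right_injective _ hs
    change (y - x) • _ = (y - x) • _
    have e : y * y * x = y := by linear_combination y * h4
    linear_combination (norm := module) -hB + e • W.coB ψ
  have hAB := W.linA_eq_linB_of_coA_coB hA' hB'
  have : ψ = W.linA (W.coA ψ) := by
    refine sub_eq_zero.1 (W.eq_zero_of_mem_sup
      (Submodule.sub_mem _ hψ (W.linA_mem_sup _)) ?_ ?_)
    · rw [map_sub, coA_linA, sub_self]
    · rw [map_sub, hAB, coB_linB, sub_self]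
  rw [mem_inf_iff]
  exact ⟨_, _, this.symm, (this.trans hAB).symm⟩

theorem exists_lift_iff (hθ : θ ∈ Set.Ioo 0 Real.pi) {φ : ℝ}
    (hφ : Complex.exp (2 * Complex.I * φ) ≠ -Complex.exp (2 * Complex.I * θ))
    (ψ : EuclideanSpace ℂ V) :
    (ψ ∈ W.spaceA ⊔ W.spaceB ∧ W.U θ ψ = Complex.exp (2 * Complex.I * φ) • ψ) ↔
    ∃ f g, W.coA (W.linB g) = ((Real.cos φ / Real.sin θ : ℝ) : ℂ) • f ∧
      W.coB (W.linA f) = ((Real.cos φ / Real.sin θ : ℝ) : ℂ) • g ∧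
      ψ = W.linA f + (Complex.I * Complex.exp (Complex.I * ((θ : ℂ) + φ))) • W.linB g := by
  have hs := (Real.sin_pos_of_mem_Ioo hθ).ne'
  have hcos : Real.cos φ = Real.cos φ / Real.sin θ * Real.sin θ := by
    rw [div_mul_cancel₀ _ hs]
  constructor
  · rintro ⟨h1, h2⟩
    by_cases hd : Complex.exp (2 * Complex.I * φ) = -Complex.exp (-2 * Complex.I * θ)
    -- Here `d = 0`. The value `l = 1` is impossible, because it would also equal the excluded
    -- `-e^{2iθ}`. So `ψ = 0`, and the zero pair serves as witness.
    · have h3 : -Complex.exp (-2 * Complex.I * θ) ≠ 1 := by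
        intro hc
        apply hφ
        rw [hd, hc, show 2 * Complex.I * (θ : ℂ) = -(-2 * Complex.I * θ) by ring, Complex.exp_neg,
          neg_eq_iff_eq_neg.1 hc]
        norm_num
      rw [hd] at h2
      have := W.eq_zero_of_U_apply_eq hθ h1 h3 h2
      exact ⟨0, 0, by simp, by simp, by simpa using this⟩
    · exact W.exists_lift_of_U_apply hcos hd h2
  · rintro ⟨f, g, h1, h2, rfl⟩
    exact ⟨Submodule.add_mem _ (W.linA_mem_sup f) (Submodule.smul_mem _ _ (W.linB_mem_sup g)),
      W.U_apply_lift hcos h1 h2⟩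

/-! ### The spectrum on the sum of the two spaces -/

theorem exists_phase_of_U_apply (hθ : θ ∈ Set.Ioo 0 Real.pi) {ψ : EuclideanSpace ℂ V}
    (hψ : ψ ∈ W.spaceA ⊔ W.spaceB) (h0 : ψ ≠ 0) {l : ℂ} (h : W.U θ ψ = l • ψ) :
    ∃ μ : ℝ, (μ : ℂ) ∈ spectrum ℂ W.T ∧ l = Complex.exp (2 * Complex.I * phase θ μ) := by
  obtain ⟨φ, hl, hφ⟩ := exists_exp_two_I_eq (W.norm_eq_one_of_U_apply_eq h0 h) θ
  have hs := (Real.sin_pos_of_mem_Ioo hθ).ne'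
  by_cases hl' : l = -Complex.exp (2 * Complex.I * θ)
  · rw [hl'] at h
    refine ⟨-1, ?_, by rw [hl', exp_phase_neg_one hθ]⟩
    have := W.mem_inf_of_U_apply_eq hθ hψ h
    push_cast
    rw [neg_one_mem_spectrum_T_iff, reversible_iff_inf_ne_bot, Submodule.ne_bot_iff]
    exact ⟨ψ, this, h0⟩
  · rw [hl] at h hl'
    obtain ⟨f, g, h1, h2, h3⟩ := (W.exists_lift_iff hθ hl' ψ).1 ⟨hψ, h⟩
    refine ⟨Real.cos φ / Real.sin θ, (W.mem_spectrum_T_iff _).2 ⟨f, g, ?_, h1, h2⟩, ?_⟩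
    · by_contra! hc
      apply h0
      rw [h3, hc.1, hc.2]
      simp
    · rw [hφ hs, hl]

theorem neg_exp_mem_spectrum_of_reversible (hW : W.Reversible)
    (hAB : ∀ ψ ∈ W.spaceA ⊔ W.spaceB, W.U θ ψ ∈ W.spaceA ⊔ W.spaceB) :
    -Complex.exp (2 * Complex.I * θ) ∈ spectrum ℂ ((W.U θ).restrict hAB) := by
  obtain ⟨ψ, h, h0⟩ := (Submodule.ne_bot_iff _).1 (W.reversible_iff_inf_ne_bot.1 hW)
  rw [Module.End.mem_spectrum_restrict_iff]
  exact ⟨ψ, Submodule.mem_sup_left h.1, h0, W.U_apply_of_mem_inf h⟩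

theorem exp_phase_mem_spectrum (hθ : θ ∈ Set.Ioo 0 Real.pi)
    (hAB : ∀ ψ ∈ W.spaceA ⊔ W.spaceB, W.U θ ψ ∈ W.spaceA ⊔ W.spaceB) {μ : ℝ}
    (hμ : (μ : ℂ) ∈ spectrum ℂ W.T) (h1 : μ ≠ 1) :
    Complex.exp (2 * Complex.I * phase θ μ) ∈ spectrum ℂ ((W.U θ).restrict hAB) := by
  -- For `μ = -1` the lift vanishes at `θ = π/2`, so the eigenvector is taken from `𝒜 ∩ ℬ` instead.
  by_cases hm : μ = -1
  · subst hm
    rw [exp_phase_neg_one hθ]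
    push_cast at hμ
    exact W.neg_exp_mem_spectrum_of_reversible (W.neg_one_mem_spectrum_T_iff.1 hμ) hAB
  have hle := W.abs_le_one_of_mem_spectrum_T hμ
  obtain ⟨f, g, h0, hf, hg⟩ := (W.mem_spectrum_T_iff _).1 hμ
  rw [Module.End.mem_spectrum_restrict_iff]
  refine ⟨_, Submodule.add_mem _ (W.linA_mem_sup f) (Submodule.smul_mem _ _ (W.linB_mem_sup g)), ?_,
    W.U_apply_lift (cos_phase hle) hf hg⟩
  have hη : Complex.I * Complex.exp (Complex.I * ((θ : ℂ) + phase θ μ)) ≠ 0 :=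
    mul_ne_zero Complex.I_ne_zero (Complex.exp_ne_zero _)
  -- As `|η| = 1`, the factor in `A†ψ = (1 + ημ)f` can vanish only for `|μ| = 1`.
  have hn : ‖Complex.I * Complex.exp (Complex.I * ((θ : ℂ) + phase θ μ))‖ = 1 := by
    rw [norm_mul, Complex.norm_I, one_mul, mul_comm, ← Complex.ofReal_add,
      Complex.norm_exp_ofReal_mul_I]
  intro hc
  have hf0 : f ≠ 0 := by
    rintro rfl
    rw [map_zero, zero_add, smul_eq_zero, or_iff_right hη] at hc
    rcases h0 with h0 | h0
    · exact h0 rfl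
    · exact h0 (W.linB_injective (by simpa using hc))
  have hA := congrArg W.coA hc
  rw [map_add, map_smul, coA_linA, hf, map_zero, smul_smul] at hA
  have hA' : (1 + Complex.I * Complex.exp (Complex.I * ((θ : ℂ) + phase θ μ)) * μ) • f = 0 := by
    rw [add_smul, one_smul, hA]
  rcases smul_eq_zero.1 hA' with h2 | h2
  · have h3 := congrArg norm (eq_neg_of_add_eq_zero_right h2)
    rw [norm_mul, hn, one_mul, norm_neg, norm_one, Complex.norm_real, Real.norm_eq_abs] at h3
    rcases eq_or_eq_neg_of_abs_eq h3 with h4 | h4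
    · exact h1 h4
    · exact hm h4
  · exact hf0 h2

theorem spectrum_sup_of_ne (hθ : θ ∈ Set.Ioo 0 Real.pi)
    (hAB : ∀ ψ ∈ W.spaceA ⊔ W.spaceB, W.U θ ψ ∈ W.spaceA ⊔ W.spaceB) (hne : θ ≠ Real.pi / 2) :
    spectrum ℂ ((W.U θ).restrict hAB) =
      {l | ∃ μ : ℝ, (μ : ℂ) ∈ spectrum ℂ W.T ∧ μ ≠ 1 ∧
        l = Complex.exp (2 * Complex.I * phase θ μ)} := by
  ext l
  constructor
  · intro hl
    obtain ⟨ψ, hψ, h0, h⟩ := (Module.End.mem_spectrum_restrict_iff hAB l).1 hl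
    obtain ⟨μ, hμ, rfl⟩ := W.exists_phase_of_U_apply hθ hψ h0 h
    refine ⟨μ, hμ, ?_, rfl⟩
    rintro rfl
    rw [exp_phase_one hθ] at h
    exact h0 (W.eq_zero_of_U_apply_eq hθ hψ (exp_neg_two_I_ne_neg_one hθ hne) h)
  · rintro ⟨μ, hμ, h1, rfl⟩
    exact W.exp_phase_mem_spectrum hθ hAB hμ h1

theorem spectrum_sup_of_not_reversible (hθ : θ ∈ Set.Ioo 0 Real.pi)
    (hAB : ∀ ψ ∈ W.spaceA ⊔ W.spaceB, W.U θ ψ ∈ W.spaceA ⊔ W.spaceB) (hW : ¬ W.Reversible) :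
    spectrum ℂ ((W.U θ).restrict hAB) =
      {l | ∃ μ : ℝ, (μ : ℂ) ∈ spectrum ℂ W.T ∧
        l = Complex.exp (2 * Complex.I * phase θ μ)} := by
  ext l
  constructor
  · intro hl
    obtain ⟨ψ, hψ, h0, h⟩ := (Module.End.mem_spectrum_restrict_iff hAB l).1 hl
    exact W.exists_phase_of_U_apply hθ hψ h0 h
  · rintro ⟨μ, hμ, rfl⟩
    refine W.exp_phase_mem_spectrum hθ hAB hμ ?_
    rintro rfl
    push_cast at hμ
    exact hW (W.one_mem_spectrum_T_iff.1 hμ)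

/-- At `θ = π/2` the values `μ = 1` and `μ = -1` give the same eigenvalue, so `μ = -1` can be
dropped in favour of `μ = 1`. -/
theorem spectrum_sup_pi_div_two (hθ : θ ∈ Set.Ioo 0 Real.pi)
    (hAB : ∀ ψ ∈ W.spaceA ⊔ W.spaceB, W.U θ ψ ∈ W.spaceA ⊔ W.spaceB) (hW : W.Reversible)
    (he : θ = Real.pi / 2) :
    spectrum ℂ ((W.U θ).restrict hAB) =
      {l | ∃ μ : ℝ, (μ : ℂ) ∈ spectrum ℂ W.T ∧ μ ≠ -1 ∧
        l = Complex.exp (2 * Complex.I * phase θ μ)} := by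
  have hp : Complex.exp (2 * Complex.I * phase θ 1) = -Complex.exp (2 * Complex.I * θ) := by
    rw [exp_phase_one hθ, he, neg_exp_pi_div_two, neg_exp_neg_pi_div_two]
  ext l
  constructor
  · intro hl
    obtain ⟨ψ, hψ, h0, h⟩ := (Module.End.mem_spectrum_restrict_iff hAB l).1 hl
    obtain ⟨μ, hμ, rfl⟩ := W.exists_phase_of_U_apply hθ hψ h0 h
    by_cases h1 : μ = -1
    · refine ⟨1, ?_, by norm_num, ?_⟩
      · rw [Complex.ofReal_one]
        exact W.one_mem_spectrum_T_iff.2 hW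
      · rw [h1, hp, exp_phase_neg_one hθ]
    · exact ⟨μ, hμ, h1, rfl⟩
  · rintro ⟨μ, hμ, h1, rfl⟩
    by_cases h1 : μ = 1
    · rw [h1, hp]
      exact W.neg_exp_mem_spectrum_of_reversible hW hAB
    · exact W.exp_phase_mem_spectrum hθ hAB hμ h1

/-- The substitution `μ ↦ -μ` preserves `σ(T)` and exchanges the two branches of the angle. -/
theorem spectrum_sup_of_lt (hθ : θ ∈ Set.Ioo 0 Real.pi)
    (hAB : ∀ ψ ∈ W.spaceA ⊔ W.spaceB, W.U θ ψ ∈ W.spaceA ⊔ W.spaceB) (hlt : Real.pi / 2 < θ) :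
    spectrum ℂ ((W.U θ).restrict hAB) =
      {l | ∃ μ : ℝ, (μ : ℂ) ∈ spectrum ℂ W.T ∧ μ ≠ -1 ∧
        l = Complex.exp (2 * Complex.I * Real.arccos (μ * Real.sin θ))} := by
  rw [W.spectrum_sup_of_ne hθ hAB hlt.ne']
  ext l
  constructor
  · rintro ⟨μ, hμ, h1, rfl⟩
    refine ⟨-μ, ?_, fun h => h1 (by linarith), ?_⟩
    · push_cast
      exact W.neg_mem_spectrum_T hμ
    · rw [exp_two_I_arccos_of_lt hlt, neg_neg]
  · rintro ⟨μ, hμ, h1, rfl⟩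
    refine ⟨-μ, ?_, fun h => h1 (by linarith), ?_⟩
    · push_cast
      exact W.neg_mem_spectrum_T hμ
    · rw [exp_two_I_arccos_of_lt hlt]

theorem map_eigenspace_sup (hθ : θ ∈ Set.Ioo 0 Real.pi)
    (hAB : ∀ ψ ∈ W.spaceA ⊔ W.spaceB, W.U θ ψ ∈ W.spaceA ⊔ W.spaceB) {φ : ℝ}
    (hφ : Complex.exp (2 * Complex.I * φ) ≠ Complex.exp (2 * Complex.I * phiMinus θ)) :
    (((Module.End.eigenspace ((W.U θ).restrict hAB) (Complex.exp (2 * Complex.I * φ))).map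
        (W.spaceA ⊔ W.spaceB).subtype : Submodule ℂ (EuclideanSpace ℂ V)) :
        Set (EuclideanSpace ℂ V)) =
      {ψ | ∃ (f : W.T₁.Tile → ℂ) (g : W.T₂.Tile → ℂ),
        Sum.elim f g ∈ LinearMap.ker (Matrix.mulVecLin
          (((Real.cos φ / Real.sin θ : ℝ) : ℂ) •
            (1 : Matrix (W.T₁.Tile ⊕ W.T₂.Tile) (W.T₁.Tile ⊕ W.T₂.Tile) ℂ) - W.T)) ∧
        ψ = W.liftA f +
          (Complex.I * Complex.exp (Complex.I * ((θ : ℂ) + φ))) • W.liftB g} := by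
  ext ψ
  rw [exp_two_I_phiMinus] at hφ
  rw [SetLike.mem_coe, Module.End.mem_map_eigenspace_restrict, W.exists_lift_iff hθ hφ]
  refine exists_congr fun f => exists_congr fun g => ?_
  rw [← and_assoc, ← T_mulVec_eq_smul_iff]
  refine and_congr ?_ Iff.rfl
  rw [LinearMap.mem_ker, Matrix.mulVecLin_apply, Matrix.sub_mulVec, Matrix.smul_mulVec,
    Matrix.one_mulVec, sub_eq_zero, eq_comm]

theorem map_eigenspace_sup_of_eq (hθ : θ ∈ Set.Ioo 0 Real.pi)
    (hAB : ∀ ψ ∈ W.spaceA ⊔ W.spaceB, W.U θ ψ ∈ W.spaceA ⊔ W.spaceB) {φ : ℝ}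
    (hφ : Complex.exp (2 * Complex.I * φ) = Complex.exp (2 * Complex.I * phiMinus θ)) :
    (Module.End.eigenspace ((W.U θ).restrict hAB) (Complex.exp (2 * Complex.I * φ))).map
      (W.spaceA ⊔ W.spaceB).subtype = W.spaceA ⊓ W.spaceB := by
  ext ψ
  rw [hφ, exp_two_I_phiMinus, Module.End.mem_map_eigenspace_restrict]
  exact ⟨fun h => W.mem_inf_of_U_apply_eq hθ h.1 h.2,
    fun h => ⟨Submodule.mem_sup_left h.1, W.U_apply_of_mem_inf h⟩⟩

end StaggeredWalk

/-! ### Walks, paths and cycles in multigraphs -/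

namespace MultiWalk

variable {α β : Type*} {Γ : Graph α β}

/-- Concatenation of walks. -/
def append : {x y z : α} → MultiWalk Γ x y → MultiWalk Γ y z → MultiWalk Γ x z
  | _, _, _, nil _, q => q
  | _, _, _, cons e h p, q => cons e h (p.append q)

@[simp] theorem edges_nil (x : α) : (nil x : MultiWalk Γ x x).edges = [] := rfl

@[simp] theorem edges_cons {x y z : α} (e : β) (h : Γ.IsLink e x y) (p : MultiWalk Γ y z) :
    (cons e h p).edges = e :: p.edges := rfl

@[simp] theorem support_nil (x : α) : (nil x : MultiWalk Γ x x).support = [x] := rfl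

@[simp] theorem support_cons {x y z : α} (e : β) (h : Γ.IsLink e x y) (p : MultiWalk Γ y z) :
    (cons e h p).support = x :: p.support := rfl

theorem support_eq_cons {x y : α} (p : MultiWalk Γ x y) : p.support = x :: p.support.tail := by
  cases p <;> rfl

theorem length_support {x y : α} (p : MultiWalk Γ x y) :
    p.support.length = p.edges.length + 1 := by
  induction p with
  | nil => rfl
  | cons e h p ih => simp [ih]

@[simp] theorem start_mem_support {x y : α} (p : MultiWalk Γ x y) : x ∈ p.support := by
  rw [support_eq_cons]; simp

@[simp] theorem end_mem_support {x y : α} (p : MultiWalk Γ x y) : y ∈ p.support := by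
  induction p with
  | nil => simp
  | cons e h p ih => simp [ih]

theorem eq_of_edges_eq_nil {x y : α} (p : MultiWalk Γ x y) (h : p.edges = []) : x = y := by
  cases p with
  | nil => rfl
  | cons e h' p => simp at h

@[simp] theorem edges_append {x y z : α} (p : MultiWalk Γ x y) (q : MultiWalk Γ y z) :
    (p.append q).edges = p.edges ++ q.edges := by
  induction p with
  | nil => rfl
  | cons e h p ih => simp [append, ih]

theorem support_append {x y z : α} (p : MultiWalk Γ x y) (q : MultiWalk Γ y z) :
    (p.append q).support = p.support ++ q.support.tail := by
  induction p with
  | nil => exact q.support_eq_cons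
  | cons e h p ih => simp [append, ih]

theorem mem_support_append {x y z w : α} (p : MultiWalk Γ x y) (q : MultiWalk Γ y z) :
    w ∈ (p.append q).support ↔ w ∈ p.support ∨ w ∈ q.support := by
  rw [support_append, q.support_eq_cons, List.mem_append, List.mem_cons, List.tail_cons]
  constructor
  · rintro (h | h)
    · exact Or.inl h
    · exact Or.inr (Or.inr h)
  · rintro (h | rfl | h)
    · exact Or.inl h
    · exact Or.inl p.end_mem_support
    · exact Or.inr h

theorem exists_append_eq {x y v : α} (p : MultiWalk Γ x y) (hv : v ∈ p.support) :
    ∃ (q : MultiWalk Γ x v) (r : MultiWalk Γ v y), q.append r = p := by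
  induction p with
  | nil x =>
    obtain rfl : v = x := by simpa using hv
    exact ⟨nil _, nil _, rfl⟩
  | cons e h p ih =>
    rw [support_cons, List.mem_cons] at hv
    rcases hv with rfl | hv
    · exact ⟨nil _, cons e h p, rfl⟩
    · obtain ⟨q, r, rfl⟩ := ih hv
      exact ⟨cons e h q, r, rfl⟩

theorem IsPath.of_append {x y z : α} {p : MultiWalk Γ x y} {q : MultiWalk Γ y z}
    (h : (p.append q).IsPath) : p.IsPath ∧ q.IsPath := by
  unfold IsPath at *
  rw [support_append, List.nodup_append] at h
  refine ⟨h.1, ?_⟩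
  rw [support_eq_cons, List.nodup_cons]
  exact ⟨fun hy => h.2.2 y p.end_mem_support y hy rfl, h.2.1⟩

theorem mem_support_of_mem_edges {x y a b : α} {p : MultiWalk Γ x y} {e : β} (he : e ∈ p.edges)
    (h : Γ.IsLink e a b) : a ∈ p.support := by
  induction p with
  | nil => simp at he
  | cons e' h' p ih =>
    rw [edges_cons, List.mem_cons] at he
    rw [support_cons, List.mem_cons]
    rcases he with rfl | he
    · rcases h.left_eq_or_eq h' with rfl | rfl
      · exact Or.inl rfl
      · exact Or.inr p.start_mem_support
    · exact Or.inr (ih he)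

theorem IsPath.edges_nodup {x y : α} {p : MultiWalk Γ x y} (h : p.IsPath) : p.edges.Nodup := by
  induction p with
  | nil => simp
  | cons e h' p ih =>
    unfold IsPath at h
    rw [support_cons, List.nodup_cons] at h
    rw [edges_cons, List.nodup_cons]
    exact ⟨fun he => h.1 (mem_support_of_mem_edges he h'), ih h.2⟩

theorem IsPath.isCycle_cons {x y : α} {q : MultiWalk Γ y x} (hq : q.IsPath) {e : β}
    (h : Γ.IsLink e x y) (he : e ∉ q.edges) : (cons e h q).IsCycle where
  edges_ne_nil := by simp
  edges_nodup := by simp [he, hq.edges_nodup]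
  support_nodup := hq

theorem exists_isPath {x y : α} (p : MultiWalk Γ x y) :
    ∃ q : MultiWalk Γ x y, q.IsPath ∧ q.edges ⊆ p.edges := by
  induction p with
  | nil x => exact ⟨nil x, by simp [IsPath], by simp⟩
  | @cons x y z e h p ih =>
    obtain ⟨q, hq, hs⟩ := ih
    by_cases hx : x ∈ q.support
    · obtain ⟨q₁, r, rfl⟩ := q.exists_append_eq hx
      refine ⟨r, hq.of_append.2, fun u hu => ?_⟩
      exact List.mem_cons_of_mem _ (hs (by simp [hu]))
    · refine ⟨cons e h q, ?_, ?_⟩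
      · unfold IsPath
        rw [support_cons, List.nodup_cons]
        exact ⟨hx, hq⟩
      · exact List.cons_subset_cons _ hs

theorem IsCycle.exists_rotate {x v : α} {c : MultiWalk Γ x x} (hc : c.IsCycle)
    (hv : v ∈ c.support) :
    ∃ c' : MultiWalk Γ v v, c'.IsCycle ∧ (∀ e, e ∈ c'.edges ↔ e ∈ c.edges) ∧
      ∀ w, w ∈ c'.support ↔ w ∈ c.support := by
  obtain ⟨q, r, rfl⟩ := c.exists_append_eq hv
  have hperm : (r.append q).edges.Perm (q.append r).edges := by
    simpa using List.perm_append_comm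
  refine ⟨r.append q, ⟨?_, hperm.nodup_iff.2 hc.edges_nodup, ?_⟩, fun e => hperm.mem_iff,
    fun w => ?_⟩
  · intro h
    rw [h] at hperm
    exact hc.edges_ne_nil hperm.nil_eq.symm
  -- Without its first vertex, the support of a concatenation is the concatenation of the two tails,
  -- so rotation merely permutes it.
  · have h := hc.support_nodup
    rw [support_append, support_eq_cons, List.cons_append, List.tail_cons] at h ⊢
    exact List.perm_append_comm.nodup_iff.1 h
  · rw [mem_support_append, mem_support_append, or_comm]

/-- A shortest path, inside a set of edges, between two sets of vertices. -/
theorem exists_connecting_path {S : Set β} {X Y : Set α} {x y : α} (hx : x ∈ X) (hy : y ∈ Y)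
    (p : MultiWalk Γ x y) (hp : ∀ e ∈ p.edges, e ∈ S) :
    ∃ (x' y' : α) (q : MultiWalk Γ x' y'), x' ∈ X ∧ y' ∈ Y ∧ q.IsPath ∧ (∀ e ∈ q.edges, e ∈ S) ∧
      (∀ v ∈ q.support, v ∈ X → v = x') ∧ (∀ v ∈ q.support, v ∈ Y → v = y') ∧
      ((∃ v, v ∈ X ∧ v ∈ Y) → q.edges = []) := by
  classical
  let P : ℕ → Prop := fun n => ∃ (x' y' : α) (q : MultiWalk Γ x' y'), x' ∈ X ∧ y' ∈ Y ∧ q.IsPath ∧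
    (∀ e ∈ q.edges, e ∈ S) ∧ q.edges.length = n
  have hP : ∃ n, P n := by
    obtain ⟨q, hq, hs⟩ := p.exists_isPath
    exact ⟨_, x, y, q, hx, hy, hq, fun e he => hp e (hs he), rfl⟩
  obtain ⟨x', y', q, hx', hy', hq, hS, hn⟩ := Nat.find_spec hP
  -- Cutting a minimal path at another vertex of `X` or `Y` would give a shorter competitor; a
  -- common vertex gives one of length zero.
  have hmin : ∀ m, P m → q.edges.length ≤ m := fun m hm => hn ▸ Nat.find_min' hP hm
  refine ⟨x', y', q, hx', hy', hq, hS, ?_, ?_, ?_⟩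
  · intro v hv hvX
    obtain ⟨q₁, r, rfl⟩ := q.exists_append_eq hv
    have := hmin _ ⟨v, y', r, hvX, hy', hq.of_append.2, fun e he => hS e (by simp [he]), rfl⟩
    rw [edges_append, List.length_append] at this
    exact (eq_of_edges_eq_nil q₁ (List.eq_nil_of_length_eq_zero (by omega))).symm
  · intro v hv hvY
    obtain ⟨q₁, r, rfl⟩ := q.exists_append_eq hv
    have := hmin _ ⟨x', v, q₁, hx', hvY, hq.of_append.1, fun e he => hS e (by simp [he]), rfl⟩
    rw [edges_append, List.length_append] at this
    exact eq_of_edges_eq_nil r (List.eq_nil_of_length_eq_zero (by omega))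
  · rintro ⟨v, hvX, hvY⟩
    have := hmin 0 ⟨v, v, nil v, hvX, hvY, by simp [IsPath], by simp, rfl⟩
    exact List.eq_nil_of_length_eq_zero (by omega)

end MultiWalk

theorem IsSpanningTree.exists_isFundamentalCycle {α β : Type*} {Γ : Graph α β} {S : Set β}
    (hS : IsSpanningTree Γ S) {e : β} (he : e ∈ Γ.edgeSet) (heS : e ∉ S) :
    ∃ (x : α) (c : MultiWalk Γ x x), IsFundamentalCycle S e c := by
  obtain ⟨x, y, h⟩ := Γ.edge_mem_iff_exists_isLink e |>.1 he
  obtain ⟨p, hp⟩ := hS.connected y h.right_mem x h.left_mem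
  obtain ⟨q, hq, hs⟩ := p.exists_isPath
  refine ⟨x, .cons e h q, hq.isCycle_cons h fun hc => heS (hp e (hs hc)), by simp, ?_⟩
  intro e' he'
  rw [MultiWalk.edges_cons, List.mem_cons] at he'
  exact he'.imp id fun h' => hp e' (hs h')

theorem IsFundamentalCycle.exists_rotate {α β : Type*} {Γ : Graph α β} {S : Set β} {e : β} {x v : α}
    {c : MultiWalk Γ x x} (hc : IsFundamentalCycle S e c) (hv : v ∈ c.support) :
    ∃ c' : MultiWalk Γ v v, IsFundamentalCycle S e c' ∧ (∀ u, u ∈ c'.edges ↔ u ∈ c.edges) ∧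
      ∀ w, w ∈ c'.support ↔ w ∈ c.support := by
  obtain ⟨c', h1, h2, h3⟩ := hc.isCycle.exists_rotate hv
  exact ⟨c', ⟨h1, (h2 e).2 hc.mem, fun u hu => hc.subset u ((h2 u).1 hu)⟩, h2, h3⟩

namespace StaggeredWalk

variable {V : Type*} [Fintype V] {G : SimpleGraph V} (W : StaggeredWalk G)

/-! ### The boundary map of the underlying multigraph -/

theorem underlying_ne_of_isLink {W : StaggeredWalk G} {u : V} {x y : W.T₁.Tile ⊕ W.T₂.Tile}
    (h : W.underlying.IsLink u x y) : x ≠ y := by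
  rcases h with ⟨rfl, rfl⟩ | ⟨rfl, rfl⟩ <;> simp

theorem amp_ne_zero (u : V) (x : W.T₁.Tile ⊕ W.T₂.Tile) : W.amp u x ≠ 0 := by
  cases x
  · exact W.a_ne_zero u
  · exact W.b_ne_zero u

/-- The weighted incidence coefficient of the edge `u` at the vertex `x`. -/
noncomputable def inc (u : V) : W.T₁.Tile ⊕ W.T₂.Tile → ℂ :=
  Sum.elim (fun i => conj (W.α i u)) (fun j => conj (W.β j u))

/-- The weighted boundary of a function on the edges of the underlying multigraph. -/
noncomputable def bdry : (V → ℂ) →ₗ[ℂ] (W.T₁.Tile ⊕ W.T₂.Tile → ℂ) where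
  toFun ψ x := ∑ u, W.inc u x * ψ u
  map_add' ψ χ := by
    ext x
    simp [mul_add, Finset.sum_add_distrib]
  map_smul' r ψ := by
    ext x
    simp [Finset.mul_sum, mul_left_comm]

theorem bdry_apply (ψ : V → ℂ) (x : W.T₁.Tile ⊕ W.T₂.Tile) :
    W.bdry ψ x = ∑ u, W.inc u x * ψ u := rfl

theorem mem_orthogonal_iff_bdry {ψ : EuclideanSpace ℂ V} :
    ψ ∈ (W.spaceA ⊔ W.spaceB)ᗮ ↔ W.bdry ψ.ofLp = 0 := by
  rw [mem_orthogonal_iff]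
  constructor
  · rintro ⟨h1, h2⟩
    ext (i | j)
    · exact (W.coA_apply ψ i).symm.trans (congrFun h1 i)
    · exact (W.swap.coA_apply ψ j).symm.trans (congrFun h2 j)
  · intro h
    exact ⟨funext fun i => (W.coA_apply ψ i).trans (congrFun h (Sum.inl i)),
      funext fun j => (W.swap.coA_apply ψ j).trans (congrFun h (Sum.inr j))⟩

theorem inc_of_isLink {u : V} {x y : W.T₁.Tile ⊕ W.T₂.Tile} (h : W.underlying.IsLink u x y) :
    W.inc u = Pi.single x (conj (W.amp u x)) + Pi.single y (conj (W.amp u y)) := by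
  rcases h with ⟨rfl, rfl⟩ | ⟨rfl, rfl⟩ <;> ext (i | j) <;>
    simp [inc, amp, α_apply, β_apply, Pi.single_apply, eq_comm, apply_ite (starRingEnd ℂ)]

theorem exists_isLink_of_inc_ne_zero {u : V} {x : W.T₁.Tile ⊕ W.T₂.Tile} (h : W.inc u x ≠ 0) :
    ∃ y, W.underlying.IsLink u x y := by
  rcases x with i | j
  · have : W.α i u ≠ 0 := fun h0 => h (by simp [inc, h0])
    rw [W.α_ne_zero_iff] at this
    exact ⟨_, Or.inl ⟨by rw [this], rfl⟩⟩
  · have : W.β j u ≠ 0 := fun h0 => h (by simp [inc, h0])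
    rw [W.β_ne_zero_iff] at this
    exact ⟨_, Or.inr ⟨by rw [this], rfl⟩⟩

theorem inc_ne_zero_of_isLink {u : V} {x y : W.T₁.Tile ⊕ W.T₂.Tile}
    (h : W.underlying.IsLink u x y) : W.inc u x ≠ 0 := by
  rw [W.inc_of_isLink h]
  simpa [Pi.single_apply, underlying_ne_of_isLink h] using W.amp_ne_zero u x

/-- A function supported on an acyclic set of edges vanishes if its boundary vanishes away from one
vertex. -/
theorem eq_zero_of_bdry_eq_zero {S : Set V}
    (hS : ∀ (x : W.T₁.Tile ⊕ W.T₂.Tile) (c : MultiWalk W.underlying x x), c.IsCycle →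
      ¬ ∀ e ∈ c.edges, e ∈ S)
    {ψ : V → ℂ} (hψ : ∀ u, ψ u ≠ 0 → u ∈ S) {x : W.T₁.Tile ⊕ W.T₂.Tile}
    (h : ∀ y ≠ x, W.bdry ψ y = 0) : ψ = 0 := by
  by_contra hne
  obtain ⟨e, he⟩ : ∃ e, ψ e ≠ 0 := by
    by_contra! hc
    exact hne (funext hc)
  let touched : W.T₁.Tile ⊕ W.T₂.Tile → Prop :=
    fun y => ∃ u w, W.underlying.IsLink u w y ∧ ψ u ≠ 0
  -- The far end `z` is the exceptional vertex `x` whenever the support of `ψ` touches `x`. A path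
  -- in the support that ends at `z` and has positive length then never starts at `x`, so the
  -- boundary condition at its start supplies another edge.
  obtain ⟨z, hz, hzx⟩ : ∃ z, touched z ∧ (touched x → z = x) := by
    by_cases hx : touched x
    · exact ⟨x, hx, fun _ => rfl⟩
    · exact ⟨Sum.inl (W.T₁.tile e), ⟨e, _, Or.inr ⟨rfl, rfl⟩, he⟩, fun h' => absurd h' hx⟩
  have key : ∀ n : ℕ, ∃ (y : W.T₁.Tile ⊕ W.T₂.Tile) (p : MultiWalk W.underlying y z),
      p.IsPath ∧ (∀ u ∈ p.edges, ψ u ≠ 0) ∧ p.edges.length = n := by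
    intro n
    induction n with
    | zero => exact ⟨z, .nil z, by simp [MultiWalk.IsPath], by simp, rfl⟩
    | succ n ih =>
      obtain ⟨y, p, hp, hsupp, hn⟩ := ih
      obtain ⟨u, w, hu, hu0, hup⟩ :
          ∃ u w, W.underlying.IsLink u w y ∧ ψ u ≠ 0 ∧ u ∉ p.edges := by
        cases p with
        | nil =>
          obtain ⟨u, w, hu, hu0⟩ := hz
          exact ⟨u, w, hu, hu0, by simp⟩
        | @cons _ y' _ e₁ h₁ p =>
          have hp' : y ∉ p.support := by
            unfold MultiWalk.IsPath at hp
            rw [MultiWalk.support_cons, List.nodup_cons] at hp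
            exact hp.1
          have he₁ : ψ e₁ ≠ 0 := hsupp e₁ (by simp)
          have hyx : y ≠ x := by
            rintro rfl
            have : z = y := hzx ⟨e₁, y', h₁.symm, he₁⟩
            exact hp' (this ▸ p.end_mem_support)
          have hb := h y hyx
          rw [bdry_apply] at hb
          obtain ⟨u, hu1, hu2⟩ : ∃ u, u ≠ e₁ ∧ W.inc u y * ψ u ≠ 0 := by
            by_contra! hc
            rw [Finset.sum_eq_single e₁ (fun u _ hu => hc u hu) (by simp)] at hb
            exact mul_ne_zero (W.inc_ne_zero_of_isLink h₁) he₁ hb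
          obtain ⟨w, hw⟩ := W.exists_isLink_of_inc_ne_zero (left_ne_zero_of_mul hu2)
          refine ⟨u, w, hw.symm, right_ne_zero_of_mul hu2, fun hc => ?_⟩
          rw [MultiWalk.edges_cons, List.mem_cons] at hc
          rcases hc with hc | hc
          · exact hu1 hc
          · exact hp' (MultiWalk.mem_support_of_mem_edges hc hw)
      -- Returning to the path would close a cycle inside `S`; otherwise the path grows.
      by_cases hw : w ∈ p.support
      · obtain ⟨q, r, rfl⟩ := p.exists_append_eq hw
        rw [MultiWalk.edges_append] at hup hsupp
        refine absurd ?_ (hS w (.cons u hu q) (hp.of_append.1.isCycle_cons hu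
          fun hc => hup (List.mem_append_left _ hc)))
        intro e' he'
        rw [MultiWalk.edges_cons, List.mem_cons] at he'
        rcases he' with rfl | he'
        · exact hψ _ hu0
        · exact hψ _ (hsupp _ (List.mem_append_left _ he'))
      · refine ⟨w, .cons u hu p, ?_, ?_, by simp [hn]⟩
        · unfold MultiWalk.IsPath
          rw [MultiWalk.support_cons, List.nodup_cons]
          exact ⟨hw, hp⟩
        · intro e' he'
          rw [MultiWalk.edges_cons, List.mem_cons] at he'
          rcases he' with rfl | he'
          · exact hu0
          · exact hsupp _ he'
  -- A path with as many edges as the graph has vertices visits one vertex too many.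
  obtain ⟨y, p, hp, -, hn⟩ := key (Fintype.card (W.T₁.Tile ⊕ W.T₂.Tile))
  have := List.Nodup.length_le_card hp
  rw [p.length_support, hn] at this
  omega

/-- By `eq_zero_of_bdry_eq_zero`, the boundary map from functions on `S` to functions on all
vertices but one is injective; dimensions are compared. -/
theorem card_add_one_le_of_acyclic [Nonempty V] {S : Set V} [Fintype S]
    (hS : ∀ (x : W.T₁.Tile ⊕ W.T₂.Tile) (c : MultiWalk W.underlying x x), c.IsCycle →
      ¬ ∀ e ∈ c.edges, e ∈ S) :
    Fintype.card S + 1 ≤ Fintype.card W.T₁.Tile + Fintype.card W.T₂.Tile := by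
  classical
  let x : W.T₁.Tile ⊕ W.T₂.Tile := Sum.inl (W.T₁.tile (Classical.arbitrary V))
  let L : (S → ℂ) →ₗ[ℂ] ({y // y ≠ x} → ℂ) :=
    LinearMap.funLeft ℂ ℂ Subtype.val ∘ₗ W.bdry ∘ₗ Function.ExtendByZero.linearMap ℂ Subtype.val
  have hL : Function.Injective L := by
    rw [← LinearMap.ker_eq_bot, LinearMap.ker_eq_bot']
    intro φ hφ
    have h0 : Function.extend Subtype.val φ (0 : V → ℂ) = 0 := by
      refine W.eq_zero_of_bdry_eq_zero hS (x := x) ?_ fun y hy => congrFun hφ ⟨y, hy⟩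
      intro u hu
      by_contra huS
      refine hu (Function.extend_apply' _ _ _ ?_)
      rintro ⟨s, rfl⟩
      exact huS s.2
    ext s
    have := congrFun h0 s
    rwa [Subtype.val_injective.extend_apply] at this
  have h1 := LinearMap.finrank_le_finrank_of_injective hL
  rw [Module.finrank_pi, Module.finrank_pi, Fintype.card_subtype_compl,
    Fintype.card_subtype_eq, Fintype.card_sum] at h1
  have h2 : 0 < Fintype.card W.T₁.Tile := Fintype.card_pos_iff.2 ⟨W.T₁.tile (Classical.arbitrary V)⟩
  omega

/-! ### Flows along walks -/

theorem kappa_ne_zero {x y : W.T₁.Tile ⊕ W.T₂.Tile} (p : MultiWalk W.underlying x y) :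
    W.kappa p ≠ 0 := by
  induction p with
  | nil => exact one_ne_zero
  | cons e h p ih => exact mul_ne_zero (div_ne_zero (W.amp_ne_zero _ _) (W.amp_ne_zero _ _)) ih

theorem headAmp_ne_zero {x y : W.T₁.Tile ⊕ W.T₂.Tile} (p : MultiWalk W.underlying x y) :
    W.headAmp p ≠ 0 := by
  cases p with
  | nil => exact one_ne_zero
  | cons e h p => exact W.amp_ne_zero _ _

theorem conj_headAmp_ne_zero {x y : W.T₁.Tile ⊕ W.T₂.Tile} (p : MultiWalk W.underlying x y) :
    conj (W.headAmp p) ≠ 0 := (map_ne_zero _).2 (W.headAmp_ne_zero p)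

/-- Each step changes sides in the bipartite multigraph. In particular, closed walks have even
length. -/
theorem even_length_iff {x y : W.T₁.Tile ⊕ W.T₂.Tile} (p : MultiWalk W.underlying x y) :
    Even p.edges.length ↔ x.isLeft = y.isLeft := by
  induction p with
  | nil => simp
  | @cons x y z e h p ih =>
    have hxy : x.isLeft = !y.isLeft := by
      rcases h with ⟨rfl, rfl⟩ | ⟨rfl, rfl⟩ <;> rfl
    rw [MultiWalk.edges_cons, List.length_cons, Nat.even_add_one, ih, hxy]
    cases y.isLeft <;> cases z.isLeft <;> simp

section flow

variable [DecidableEq V]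

theorem bdry_single {u : V} {x y : W.T₁.Tile ⊕ W.T₂.Tile} (h : W.underlying.IsLink u x y) (t : ℂ) :
    W.bdry (Pi.single u t) =
      Pi.single x (conj (W.amp u x) * t) + Pi.single y (conj (W.amp u y) * t) := by
  ext v
  rw [bdry_apply, Finset.sum_eq_single u (fun w _ hw => by simp [hw]) (by simp), W.inc_of_isLink h]
  simp [Pi.single_apply, add_mul]

/-- The balance equations built into `flow` cancel the contributions at the inner vertices, and each
step multiplies what is passed on by minus the conjugate amplitude quotient. By linearity this also
holds for walks with repeated edges. -/
theorem bdry_flow {x y : W.T₁.Tile ⊕ W.T₂.Tile} (p : MultiWalk W.underlying x y) (z : ℂ) :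
    W.bdry (W.flow p z) =
      Pi.single x z - Pi.single y ((-1) ^ p.edges.length * conj (W.kappa p) * z) := by
  induction p generalizing z with
  | nil x =>
    have : W.flow (.nil x) z = 0 := rfl
    rw [this, map_zero]
    simp [kappa]
  | @cons x y w e h p ih =>
    have h1 : conj (W.amp e x) ≠ 0 := (map_ne_zero _).2 (W.amp_ne_zero e x)
    rw [flow, map_add, W.bdry_single h, ih, mul_div_cancel₀ _ h1, kappa, MultiWalk.edges_cons,
      List.length_cons, Pi.single_neg]
    have h2 : (-1) ^ p.edges.length * conj (W.kappa p) *
        -(conj (W.amp e y) * (z / conj (W.amp e x))) =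
        (-1) ^ (p.edges.length + 1) * conj (W.amp e y / W.amp e x * W.kappa p) * z := by
      rw [map_mul, map_div₀]; ring
    rw [h2]
    abel

theorem flow_apply_of_notMem {x y : W.T₁.Tile ⊕ W.T₂.Tile} (p : MultiWalk W.underlying x y) (z : ℂ)
    {u : V} (hu : u ∉ p.edges) : W.flow p z u = 0 := by
  induction p generalizing z with
  | nil => rfl
  | cons e h p ih =>
    rw [MultiWalk.edges_cons, List.mem_cons, not_or] at hu
    rw [flow, Pi.add_apply, Pi.single_eq_of_ne hu.1, ih _ hu.2, add_zero]

theorem flow_apply_ne_zero {x y : W.T₁.Tile ⊕ W.T₂.Tile} (p : MultiWalk W.underlying x y) {z : ℂ}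
    (hz : z ≠ 0) (hp : p.edges.Nodup) {u : V} (hu : u ∈ p.edges) : W.flow p z u ≠ 0 := by
  induction p generalizing z with
  | nil => simp at hu
  | @cons x y w e h p ih =>
    have h1 : conj (W.amp e x) ≠ 0 := (map_ne_zero _).2 (W.amp_ne_zero e x)
    have h2 : conj (W.amp e y) ≠ 0 := (map_ne_zero _).2 (W.amp_ne_zero e y)
    rw [MultiWalk.edges_cons, List.nodup_cons] at hp
    rw [MultiWalk.edges_cons, List.mem_cons] at hu
    rw [flow, Pi.add_apply]
    by_cases hue : u = e
    · subst hue
      rw [W.flow_apply_of_notMem p _ hp.1, Pi.single_eq_same, add_zero]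
      exact div_ne_zero hz h1
    · rw [Pi.single_eq_of_ne hue, zero_add]
      exact ih (neg_ne_zero.2 (mul_ne_zero h2 (div_ne_zero hz h1))) hp.2 (hu.resolve_left hue)

theorem flow_apply_ne_zero_iff {x y : W.T₁.Tile ⊕ W.T₂.Tile} (p : MultiWalk W.underlying x y)
    {z : ℂ} (hz : z ≠ 0) (hp : p.edges.Nodup) (u : V) : W.flow p z u ≠ 0 ↔ u ∈ p.edges :=
  ⟨fun h => not_not.1 fun hu => h (W.flow_apply_of_notMem p z hu), W.flow_apply_ne_zero p hz hp⟩

/-- Even length removes the sign, and the two end contributions combine to `1 - conj κ(c)` times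
`z`. -/
theorem bdry_flow_closed {x : W.T₁.Tile ⊕ W.T₂.Tile} (c : MultiWalk W.underlying x x) (z : ℂ) :
    W.bdry (W.flow c z) = Pi.single x (-(conj (W.balance c) * z)) := by
  rw [bdry_flow, ((W.even_length_iff c).2 rfl).neg_one_pow, ← Pi.single_sub, balance, map_sub,
    map_one]
  congr 1
  ring

theorem cycleVec_mem_orthogonal {x : W.T₁.Tile ⊕ W.T₂.Tile} {c : MultiWalk W.underlying x x}
    (h : W.balance c = 0) : W.cycleVec c ∈ (W.spaceA ⊔ W.spaceB)ᗮ := by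
  rw [mem_orthogonal_iff_bdry, cycleVec, bdry_flow_closed, h]
  simp

theorem cycleVec_apply_ne_zero_iff {x : W.T₁.Tile ⊕ W.T₂.Tile} {c : MultiWalk W.underlying x x}
    (hc : c.IsCycle) (u : V) : W.cycleVec c u ≠ 0 ↔ u ∈ c.edges :=
  W.flow_apply_ne_zero_iff c (W.conj_headAmp_ne_zero c) hc.edges_nodup u

end flow

end StaggeredWalk

/-! ### Families of vectors diagonal in selected coordinates -/

theorem EuclideanSpace.eq_span_of_triangular {ι V : Type*} [Fintype ι] [Fintype V]
    {P : Submodule ℂ (EuclideanSpace ℂ V)} (i : ι → V) (ψ : ι → EuclideanSpace ℂ V)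
    (hmem : ∀ e, ψ e ∈ P) (hne : ∀ e, ψ e (i e) ≠ 0) (hz : ∀ e e', e ≠ e' → ψ e (i e') = 0)
    (huniq : ∀ φ ∈ P, (∀ e, φ (i e) = 0) → φ = 0) :
    P = Submodule.span ℂ (Set.range ψ) := by
  apply le_antisymm
  · intro φ hφ
    have hsum : ∀ e', (∑ e, (φ (i e) / ψ e (i e)) • ψ e) (i e') = φ (i e') := by
      intro e'
      rw [WithLp.ofLp_sum, Finset.sum_apply,
        Finset.sum_eq_single e' (fun e _ he => by simp [hz e e' he]) (by simp)]
      simp [hne e']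
    have h0 := huniq (φ - ∑ e, (φ (i e) / ψ e (i e)) • ψ e)
      (P.sub_mem hφ (P.sum_mem fun e _ => P.smul_mem _ (hmem e)))
      (fun e' => by rw [PiLp.sub_apply, hsum, sub_self])
    rw [sub_eq_zero.1 h0]
    exact Submodule.sum_mem _ fun e _ => Submodule.smul_mem _ _ (Submodule.subset_span ⟨e, rfl⟩)
  · rw [Submodule.span_le]
    rintro _ ⟨e, rfl⟩
    exact hmem e

theorem EuclideanSpace.card_le_finrank_of_triangular {ι V : Type*} [Fintype ι] [Fintype V]
    {P : Submodule ℂ (EuclideanSpace ℂ V)} (i : ι → V) (ψ : ι → EuclideanSpace ℂ V)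
    (hmem : ∀ e, ψ e ∈ P) (hne : ∀ e, ψ e (i e) ≠ 0) (hz : ∀ e e', e ≠ e' → ψ e (i e') = 0) :
    Fintype.card ι ≤ Module.finrank ℂ P := by
  have hli : LinearIndependent ℂ (fun e => (⟨ψ e, hmem e⟩ : P)) := by
    rw [Fintype.linearIndependent_iff]
    intro g hg e'
    have h1 : ∑ e, g e • ψ e = 0 := by
      have := congrArg Subtype.val hg
      simpa using this
    have h2 : (∑ e, g e • ψ e) (i e') = g e' * ψ e' (i e') := by
      rw [WithLp.ofLp_sum, Finset.sum_apply,
        Finset.sum_eq_single e' (fun e _ he => by simp [hz e e' he]) (by simp)]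
      simp
    rw [h1] at h2
    exact (mul_eq_zero.1 h2.symm).resolve_right (hne e')
  exact hli.fintype_card_le_finrank

namespace StaggeredWalk

variable {V : Type*} [Fintype V] {G : SimpleGraph V} (W : StaggeredWalk G)

/-! ### Balanced cycles -/

theorem IsReversibleEigenfunction.ne_zero_apply {W : StaggeredWalk G} (hG : G.Connected)
    {ϖ : W.T₁.Tile ⊕ W.T₂.Tile → ℂ} (h : W.IsReversibleEigenfunction ϖ)
    (x : W.T₁.Tile ⊕ W.T₂.Tile) : ϖ x ≠ 0 := by
  obtain ⟨h1, h2⟩ := h.linA_eq_linB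
  have h3 : ∀ u, W.linA (ϖ ∘ Sum.inl) u ≠ 0 :=
    fun u h0 => h2 (W.linA_eq_zero_of_apply_eq_zero hG h1 h0)
  rcases x with i | j
  · obtain ⟨u, rfl⟩ := Quotient.exists_rep i
    have h4 : W.liftA (ϖ ∘ Sum.inl) u ≠ 0 := h3 u
    rw [liftA_apply] at h4
    exact right_ne_zero_of_mul h4
  · obtain ⟨u, rfl⟩ := Quotient.exists_rep j
    have h4 : W.liftB (ϖ ∘ Sum.inr) u ≠ 0 := by
      have := h3 u
      rwa [h1] at this
    rw [liftB_apply] at h4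
    exact right_ne_zero_of_mul h4

/-- By detailed balance the factor of a step from `x` to `y` is `ϖ x / ϖ y`, so the product
telescopes. -/
theorem IsReversibleEigenfunction.kappa_mul {W : StaggeredWalk G}
    {ϖ : W.T₁.Tile ⊕ W.T₂.Tile → ℂ} (h : W.IsReversibleEigenfunction ϖ)
    {x y : W.T₁.Tile ⊕ W.T₂.Tile} (p : MultiWalk W.underlying x y) : W.kappa p * ϖ y = ϖ x := by
  induction p with
  | nil => simp [kappa]
  | @cons x y z e hl p ih =>
    have h1 : W.amp e y * ϖ y = W.amp e x * ϖ x := by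
      rcases hl with ⟨rfl, rfl⟩ | ⟨rfl, rfl⟩
      · exact (h.2.2 e).symm
      · exact h.2.2 e
    rw [kappa, mul_assoc, ih, div_mul_eq_mul_div, h1, mul_div_cancel_left₀ _ (W.amp_ne_zero e x)]

theorem balance_eq_zero_of_reversible (hG : G.Connected) (hW : W.Reversible)
    {x : W.T₁.Tile ⊕ W.T₂.Tile} (c : MultiWalk W.underlying x x) : W.balance c = 0 := by
  obtain ⟨ϖ, h⟩ := hW
  have h1 := h.kappa_mul c
  rw [balance, sub_eq_zero]
  exact mul_right_cancel₀ (h.ne_zero_apply hG x) (h1.trans (one_mul _).symm)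

/-- An edge of `G` inside a polygon of `𝒯₁` needs no step; one inside a polygon of `𝒯₂` becomes two
steps through that polygon. -/
theorem nonempty_multiWalk (hG : G.Connected) (x y : W.T₁.Tile ⊕ W.T₂.Tile) :
    Nonempty (MultiWalk W.underlying x y) := by
  have key : ∀ u v, G.Walk u v → Nonempty (MultiWalk W.underlying
      (Sum.inl (W.T₁.tile u)) (Sum.inl (W.T₁.tile v))) := by
    intro u v p
    induction p with
    | nil => exact ⟨.nil _⟩
    | @cons u v w h _ ih =>
      obtain ⟨p⟩ := ih
      rcases W.cover u v h with h1 | h1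
      · rw [show W.T₁.tile u = W.T₁.tile v from Quotient.sound h1]
        exact ⟨p⟩
      · have h2 : W.T₂.tile u = W.T₂.tile v := Quotient.sound h1
        exact ⟨.cons u (Or.inl ⟨rfl, rfl⟩) (.cons v (Or.inr ⟨by rw [h2], rfl⟩) p)⟩
  have out : ∃ u, Nonempty (MultiWalk W.underlying x (Sum.inl (W.T₁.tile u))) := by
    rcases x with i | j
    · obtain ⟨u, rfl⟩ := Quotient.exists_rep i
      exact ⟨u, ⟨.nil _⟩⟩
    · obtain ⟨u, rfl⟩ := Quotient.exists_rep j
      exact ⟨u, ⟨.cons u (Or.inr ⟨rfl, rfl⟩) (.nil _)⟩⟩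
  have into : ∃ u, Nonempty (MultiWalk W.underlying (Sum.inl (W.T₁.tile u)) y) := by
    rcases y with i | j
    · obtain ⟨u, rfl⟩ := Quotient.exists_rep i
      exact ⟨u, ⟨.nil _⟩⟩
    · obtain ⟨u, rfl⟩ := Quotient.exists_rep j
      exact ⟨u, ⟨.cons u (Or.inl ⟨rfl, rfl⟩) (.nil _)⟩⟩
  obtain ⟨u, ⟨p⟩⟩ := out
  obtain ⟨v, ⟨q⟩⟩ := into
  obtain ⟨r⟩ := hG.preconnected u v
  obtain ⟨r'⟩ := key u v r
  exact ⟨p.append (r'.append q)⟩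

/-! ### Cycle-paths and their vectors -/

theorem exists_cyclePath {S : Set V} (hS : IsSpanningTree W.underlying S) {e₀ e : V}
    (he₀ : e₀ ∉ S) (he : e ∉ S) : ∃ D : W.CyclePath S e₀ e, ∀ u ∈ D.p.edges, u ∈ S := by
  obtain ⟨x, c₀, h₀⟩ := hS.exists_isFundamentalCycle (Set.mem_univ e₀) he₀
  obtain ⟨y, c, h⟩ := hS.exists_isFundamentalCycle (Set.mem_univ e) he
  obtain ⟨p, hp⟩ := hS.connected x (Set.mem_univ x) y (Set.mem_univ y)
  -- A shortest tree path between the two cycles meets each of them in one vertex only, while a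
  -- shared edge would have two distinct endpoints there. The cycles are then rotated to start at
  -- its ends.
  obtain ⟨x', y', q, hx', hy', hq, hqS, hX, hY, hnil⟩ :=
    MultiWalk.exists_connecting_path (X := {v | v ∈ c₀.support}) (Y := {v | v ∈ c.support})
      c₀.start_mem_support c.start_mem_support p hp
  obtain ⟨c₀', h₀', he₀', hs₀'⟩ := h₀.exists_rotate hx'
  obtain ⟨c', h', he', hs'⟩ := h.exists_rotate hy'
  refine ⟨⟨x', y', c₀', c', q, h₀', h', hq, ?_, ?_⟩, hqS⟩
  · intro u hu
    obtain ⟨a, b, hab⟩ : ∃ a b, W.underlying.IsLink u a b := ⟨_, _, Or.inl ⟨rfl, rfl⟩⟩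
    have ha := MultiWalk.mem_support_of_mem_edges hu hab
    have hb := MultiWalk.mem_support_of_mem_edges hu hab.symm
    constructor
    · intro hc
      have ha' := (hs₀' _).1 (MultiWalk.mem_support_of_mem_edges hc hab)
      have hb' := (hs₀' _).1 (MultiWalk.mem_support_of_mem_edges hc hab.symm)
      exact underlying_ne_of_isLink hab ((hX a ha ha').trans (hX b hb hb').symm)
    · intro hc
      have ha' := (hs' _).1 (MultiWalk.mem_support_of_mem_edges hc hab)
      have hb' := (hs' _).1 (MultiWalk.mem_support_of_mem_edges hc hab.symm)
      exact underlying_ne_of_isLink hab ((hY a ha ha').trans (hY b hb hb').symm)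
  · rintro ⟨v, hv1, hv2⟩
    exact hnil ⟨v, (hs₀' v).1 hv1, (hs' v).1 hv2⟩

theorem cyclePathVec_coeff_ne_zero {S : Set V} {e₀ e : V} (D : W.CyclePath S e₀ e)
    (h₀ : W.balance D.c₀ ≠ 0) (h : W.balance D.c ≠ 0) :
    conj ((-1) ^ (D.p.edges.length + 1) * W.kappa D.p * W.headAmp D.c₀ *
        W.balance D.c₀ / W.balance D.c) ≠ 0 := by
  refine (map_ne_zero _).2 (div_ne_zero (mul_ne_zero (mul_ne_zero (mul_ne_zero ?_ ?_) ?_) h₀) h)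
  · exact pow_ne_zero _ (by norm_num)
  · exact W.kappa_ne_zero _
  · exact W.headAmp_ne_zero _

theorem eq_zero_of_mem_orthogonal [Nonempty V] {S : Set V} (hS : IsSpanningTree W.underlying S)
    {φ : EuclideanSpace ℂ V} (hφ : φ ∈ (W.spaceA ⊔ W.spaceB)ᗮ) (h : ∀ u ∉ S, φ u = 0) : φ = 0 := by
  rw [mem_orthogonal_iff_bdry] at hφ
  have := W.eq_zero_of_bdry_eq_zero hS.acyclic (ψ := φ.ofLp)
    (fun u hu => not_not.1 fun hc => hu (h u hc))
    (x := Sum.inl (W.T₁.tile (Classical.arbitrary V))) (fun y _ => congrFun hφ y)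
  ext u
  exact congrFun this u

theorem orthogonal_eq_bot_of_isMultiTree (hG : G.Connected) (h : IsMultiTree W.underlying) :
    (W.spaceA ⊔ W.spaceB)ᗮ = ⊥ := by
  have := hG.nonempty
  rw [Submodule.eq_bot_iff]
  intro φ hφ
  exact W.eq_zero_of_mem_orthogonal h hφ fun u hu => absurd (Set.mem_univ u) hu

section vectors

variable [DecidableEq V]

/-- The path cancels the defect of `c₀` at `x` and carries it to `y`. The coefficient of the flow on
`c` is chosen so that its own defect cancels what arrives there. -/
theorem cyclePathVec_mem_orthogonal {S : Set V} {e₀ e : V} (D : W.CyclePath S e₀ e) :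
    W.cyclePathVec D ∈ (W.spaceA ⊔ W.spaceB)ᗮ := by
  unfold cyclePathVec
  split_ifs with h
  · exact W.cycleVec_mem_orthogonal h
  · have h' : conj (W.balance D.c) ≠ 0 := (map_ne_zero _).2 h
    have h2 : conj (W.balance D.c) * conj ((-1) ^ (D.p.edges.length + 1) * W.kappa D.p *
        W.headAmp D.c₀ * W.balance D.c₀ / W.balance D.c) =
        (-1) ^ (D.p.edges.length + 1) * conj (W.kappa D.p) * conj (W.headAmp D.c₀) *
          conj (W.balance D.c₀) := by
      rw [map_div₀, mul_div_cancel₀ _ h']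
      simp
    rw [mem_orthogonal_iff_bdry, map_add, map_add, bdry_flow_closed, bdry_flow_closed, bdry_flow,
      h2, map_mul, mul_comm (conj (W.balance D.c₀)), Pi.single_neg]
    have h3 : -((-1 : ℂ) ^ (D.p.edges.length + 1) * conj (W.kappa D.p) * conj (W.headAmp D.c₀) *
        conj (W.balance D.c₀)) = (-1) ^ D.p.edges.length * conj (W.kappa D.p) *
          (conj (W.headAmp D.c₀) * conj (W.balance D.c₀)) := by ring
    rw [h3]
    abel

/-- The edge `e` lies on neither `c₀` nor the path, so only the flow around `c` contributes. -/
theorem cyclePathVec_apply_ne_zero {S : Set V} {e₀ e : V} (D : W.CyclePath S e₀ e)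
    (he : e ∉ S) (hne : e ≠ e₀) (h₀ : W.balance D.c₀ ≠ 0) : W.cyclePathVec D e ≠ 0 := by
  have hmem := D.fund.mem
  unfold cyclePathVec
  split_ifs with h
  · exact (W.cycleVec_apply_ne_zero_iff D.fund.isCycle e).2 hmem
  · have h1 : e ∉ D.c₀.edges := fun h' => (D.fund₀.subset e h').elim hne he
    have h2 : e ∉ D.p.edges := fun h' => (D.disjoint e h').2 hmem
    change (W.flow D.c₀ _ + W.flow D.p _ + W.flow D.c _) e ≠ 0
    rw [Pi.add_apply, Pi.add_apply, W.flow_apply_of_notMem _ _ h1, W.flow_apply_of_notMem _ _ h2,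
      zero_add, zero_add]
    exact W.flow_apply_ne_zero _ (W.cyclePathVec_coeff_ne_zero D h₀ h) D.fund.isCycle.edges_nodup
      hmem

theorem cyclePathVec_apply_eq_zero {S : Set V} {e₀ e u : V} (D : W.CyclePath S e₀ e)
    (hD : ∀ u ∈ D.p.edges, u ∈ S) (hu : u ∉ S) (hu₀ : u ≠ e₀) (hue : u ≠ e) :
    W.cyclePathVec D u = 0 := by
  have h1 : u ∉ D.c₀.edges := fun h' => (D.fund₀.subset u h').elim hu₀ hu
  have h2 : u ∉ D.p.edges := fun h' => hu (hD u h')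
  have h3 : u ∉ D.c.edges := fun h' => (D.fund.subset u h').elim hue hu
  unfold cyclePathVec
  split_ifs with h
  · exact W.flow_apply_of_notMem _ _ h3
  · change (W.flow D.c₀ _ + W.flow D.p _ + W.flow D.c _) u = 0
    rw [Pi.add_apply, Pi.add_apply, W.flow_apply_of_notMem _ _ h1, W.flow_apply_of_notMem _ _ h2,
      W.flow_apply_of_notMem _ _ h3, zero_add, zero_add]

theorem support_cyclePathVec {S : Set V} {e₀ e : V} (D : W.CyclePath S e₀ e)
    (h₀ : W.balance D.c₀ ≠ 0) (h : W.balance D.c ≠ 0) (hdisj : ∀ u ∈ D.c₀.edges, u ∉ D.c.edges) :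
    {u | W.cyclePathVec D u ≠ 0} = {u | u ∈ D.c₀.edges ∨ u ∈ D.p.edges ∨ u ∈ D.c.edges} := by
  have n1 := W.flow_apply_ne_zero_iff D.c₀ (W.conj_headAmp_ne_zero D.c₀)
    D.fund₀.isCycle.edges_nodup
  have n2 := W.flow_apply_ne_zero_iff D.p (z := conj (W.headAmp D.c₀ * W.balance D.c₀))
    ((map_ne_zero _).2 (mul_ne_zero (W.headAmp_ne_zero _) h₀)) D.isPath.edges_nodup
  have n3 := W.flow_apply_ne_zero_iff D.c (W.cyclePathVec_coeff_ne_zero D h₀ h)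
    D.fund.isCycle.edges_nodup
  ext u
  have d1 := hdisj u
  have d2 := D.disjoint u
  rw [Set.mem_ofPred_eq, Set.mem_ofPred_eq, ← n1, ← n2, ← n3]
  rw [← n1, ← n3] at d1
  rw [← n1, ← n2, ← n3] at d2
  unfold cyclePathVec
  rw [if_neg h]
  change (W.flow D.c₀ _ + W.flow D.p _ + W.flow D.c _) u ≠ 0 ↔ _
  rw [Pi.add_apply, Pi.add_apply]
  generalize W.flow D.c₀ _ u = r at *
  generalize W.flow D.p _ u = s at *
  generalize W.flow D.c _ u = t at *
  -- At most one of the three flows is nonzero at a given edge, so no cancellation occurs.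
  by_cases hr : r = 0 <;> by_cases hs : s = 0 <;> by_cases ht : t = 0 <;> simp_all

/-! ### Bases of the orthogonal complement -/

/-- Subtracting a multiple of `ψ_c` clears the value at `e₀` and leaves a function on the tree whose
boundary sits at one vertex, hence zero. So `φ` is a multiple of `ψ_c`; since `ψ_c` has nonzero
boundary, the multiple is zero. -/
theorem eq_zero_of_mem_orthogonal_of_unbalanced {S : Set V} (hS : IsSpanningTree W.underlying S)
    {e₀ : V} {x : W.T₁.Tile ⊕ W.T₂.Tile} {c : MultiWalk W.underlying x x}
    (hc : IsFundamentalCycle S e₀ c) (hb : W.balance c ≠ 0) {φ : EuclideanSpace ℂ V}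
    (hφ : φ ∈ (W.spaceA ⊔ W.spaceB)ᗮ) (h : ∀ u ∉ S, u ≠ e₀ → φ u = 0) : φ = 0 := by
  rw [mem_orthogonal_iff_bdry] at hφ
  have hz := W.conj_headAmp_ne_zero c
  have h1 : W.cycleVec c e₀ ≠ 0 := (W.cycleVec_apply_ne_zero_iff hc.isCycle e₀).2 hc.mem
  have hbd : W.bdry (φ - (φ e₀ / W.cycleVec c e₀) • W.cycleVec c).ofLp =
      Pi.single x (φ e₀ / W.cycleVec c e₀ * (conj (W.balance c) * conj (W.headAmp c))) := by
    rw [WithLp.ofLp_sub, WithLp.ofLp_smul, map_sub, map_smul, hφ, cycleVec, bdry_flow_closed,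
      Pi.single_neg, smul_neg, zero_sub, neg_neg, ← Pi.single_smul, smul_eq_mul]
  have h2 := W.eq_zero_of_bdry_eq_zero hS.acyclic
    (ψ := (φ - (φ e₀ / W.cycleVec c e₀) • W.cycleVec c).ofLp) (x := x)
    (by
      intro u hu
      by_contra huS
      apply hu
      by_cases hue : u = e₀
      · subst hue
        rw [PiLp.sub_apply, PiLp.smul_apply, smul_eq_mul, div_mul_cancel₀ _ h1, sub_self]
      · have h3 : W.cycleVec c u = 0 :=
          W.flow_apply_of_notMem _ _ fun h' => (hc.subset u h').elim hue huS
        rw [PiLp.sub_apply, PiLp.smul_apply, h3, h u huS hue, smul_zero, sub_zero])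
    (fun y hy => by rw [hbd, Pi.single_eq_of_ne hy])
  rw [h2, map_zero] at hbd
  have h3 := congrFun hbd x
  rw [Pi.single_eq_same, Pi.zero_apply, eq_comm, mul_eq_zero,
    or_iff_left (mul_ne_zero ((map_ne_zero _).2 hb) hz)] at h3
  rw [h3, zero_smul, sub_zero] at h2
  ext u
  exact congrFun h2 u

theorem orthogonal_eq_span_cycleVec [Nonempty V] {S : Set V} (hS : IsSpanningTree W.underlying S)
    {x : (Sᶜ : Set V) → W.T₁.Tile ⊕ W.T₂.Tile}
    {c : ∀ e : (Sᶜ : Set V), MultiWalk W.underlying (x e) (x e)}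
    (hc : ∀ e : (Sᶜ : Set V), IsFundamentalCycle S (e : V) (c e))
    (hb : ∀ e, W.balance (c e) = 0) :
    (W.spaceA ⊔ W.spaceB)ᗮ = Submodule.span ℂ (Set.range fun e => W.cycleVec (c e)) := by
  classical
  refine EuclideanSpace.eq_span_of_triangular (fun e : (Sᶜ : Set V) => (e : V)) _
    (fun e => W.cycleVec_mem_orthogonal (hb e))
    (fun e => (W.cycleVec_apply_ne_zero_iff (hc e).isCycle e).2 (hc e).mem) ?_ ?_
  · intro e e' hne
    exact W.flow_apply_of_notMem _ _ fun h' =>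
      ((hc e).subset e' h').elim (fun h => hne (Subtype.ext h.symm)) e'.2
  · intro φ hφ h
    exact W.eq_zero_of_mem_orthogonal hS hφ fun u hu => h ⟨u, hu⟩

/-- Otherwise every non-tree edge has a balanced fundamental cycle. Their vectors are independent
and number at least `ν - (m + n) + 1`, one more than the dimension of `(𝒜 + ℬ)ᗮ`. -/
theorem exists_unbalanced [Nonempty V] (hW : ¬ W.Reversible) {S : Set V}
    (hS : IsSpanningTree W.underlying S) :
    ∃ e₀ ∉ S, ∀ (x : W.T₁.Tile ⊕ W.T₂.Tile) (c : MultiWalk W.underlying x x),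
      IsFundamentalCycle S e₀ c → W.balance c ≠ 0 := by
  classical
  by_contra! hcon
  choose x c hc hb using hcon
  have h1 := EuclideanSpace.card_le_finrank_of_triangular (P := (W.spaceA ⊔ W.spaceB)ᗮ)
    (fun e : (Sᶜ : Set V) => (e : V)) (fun e => W.cycleVec (c e e.2))
    (fun e => W.cycleVec_mem_orthogonal (hb e e.2))
    (fun e => (W.cycleVec_apply_ne_zero_iff (hc e e.2).isCycle e).2 (hc e e.2).mem)
    (fun e e' hne => W.flow_apply_of_notMem _ _ fun h' =>
      ((hc e e.2).subset e' h').elim (fun h => hne (Subtype.ext h.symm)) e'.2)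
  have h2 := W.finrank_orthogonal_of_not_reversible hW
  have h3 := W.card_add_one_le_of_acyclic hS.acyclic
  have h4 : Fintype.card S + Fintype.card (Sᶜ : Set V) = Fintype.card V := by
    rw [← Fintype.card_sum]
    exact Fintype.card_congr (Equiv.Set.sumCompl S)
  rw [betti] at h2
  omega

theorem orthogonal_eq_span_cyclePathVec {S : Set V} (hS : IsSpanningTree W.underlying S) {e₀ : V}
    (he₀ : e₀ ∉ S)
    (hb : ∀ (x : W.T₁.Tile ⊕ W.T₂.Tile) (c : MultiWalk W.underlying x x),
      IsFundamentalCycle S e₀ c → W.balance c ≠ 0)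
    (D : ∀ e : {e : V // e ∉ S ∧ e ≠ e₀}, W.CyclePath S e₀ e)
    (hD : ∀ e, ∀ u ∈ (D e).p.edges, u ∈ S) :
    (W.spaceA ⊔ W.spaceB)ᗮ = Submodule.span ℂ (Set.range fun e => W.cyclePathVec (D e)) := by
  classical
  refine EuclideanSpace.eq_span_of_triangular
    (fun e : {e : V // e ∉ S ∧ e ≠ e₀} => (e : V)) _
    (fun e => W.cyclePathVec_mem_orthogonal (D e))
    (fun e => W.cyclePathVec_apply_ne_zero (D e) e.2.1 e.2.2 (hb _ _ (D e).fund₀)) ?_ ?_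
  · intro e e' hne
    exact W.cyclePathVec_apply_eq_zero (D e) (hD e) e'.2.1 e'.2.2
      fun h => hne (Subtype.ext h.symm)
  · intro φ hφ h
    obtain ⟨x, c, hc⟩ := hS.exists_isFundamentalCycle (Set.mem_univ e₀) he₀
    exact W.eq_zero_of_mem_orthogonal_of_unbalanced hS hc (hb x c hc) hφ
      fun u hu hne => h ⟨u, hu, hne⟩

/-- In the reversible case every cycle is balanced, so any cycle would give a nonzero vector of the
complement. -/
theorem isMultiTree_of_orthogonal_eq_bot (hG : G.Connected) (hW : W.Reversible)
    (h : (W.spaceA ⊔ W.spaceB)ᗮ = ⊥) : IsMultiTree W.underlying where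
  subset := subset_rfl
  connected x _ y _ := by
    obtain ⟨p⟩ := W.nonempty_multiWalk hG x y
    exact ⟨p, fun _ _ => Set.mem_univ _⟩
  acyclic x c hc := by
    exfalso
    have h1 := W.cycleVec_mem_orthogonal (W.balance_eq_zero_of_reversible hG hW c)
    rw [h, Submodule.mem_bot] at h1
    obtain ⟨e, he⟩ := List.exists_mem_of_ne_nil _ hc.edges_ne_nil
    exact (W.cycleVec_apply_ne_zero_iff hc e).2 he (by rw [h1]; rfl)

theorem orthogonal_eq_bot_iff (hG : G.Connected) :
    (W.spaceA ⊔ W.spaceB)ᗮ = ⊥ ↔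
      IsMultiTree W.underlying ∨ (W.betti = 1 ∧ ¬ W.Reversible) := by
  constructor
  · intro h
    by_cases hW : W.Reversible
    · exact Or.inl (W.isMultiTree_of_orthogonal_eq_bot hG hW h)
    · have := W.finrank_orthogonal_of_not_reversible hW
      rw [h, finrank_bot] at this
      exact Or.inr ⟨by push_cast at this; omega, hW⟩
  · rintro (h | ⟨h, hW⟩)
    · exact W.orthogonal_eq_bot_of_isMultiTree hG h
    · have := W.finrank_orthogonal_of_not_reversible hW
      rw [h] at this
      exact Submodule.finrank_eq_zero.1 (by omega)

end vectors

end StaggeredWalk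

/-! ### The theorem -/

theorem mainTheorem1 {V : Type*} [Fintype V] [DecidableEq V] (G : SimpleGraph V)
    (hG : G.Connected) (W : StaggeredWalk G) (θ : ℝ) (hθ : θ ∈ Set.Ioo 0 Real.pi) :
    -- both subspaces are invariant and decompose the whole space
    ∃ (hAB : ∀ ψ ∈ W.spaceA ⊔ W.spaceB, W.U θ ψ ∈ W.spaceA ⊔ W.spaceB)
      (hperp : ∀ ψ ∈ (W.spaceA ⊔ W.spaceB)ᗮ, W.U θ ψ ∈ (W.spaceA ⊔ W.spaceB)ᗮ),
      IsCompl (W.spaceA ⊔ W.spaceB) (W.spaceA ⊔ W.spaceB)ᗮ ∧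
      -- the spectrum on `𝒜 + ℬ`
      (¬ W.Reversible →
        spectrum ℂ ((W.U θ).restrict hAB) =
          {l | ∃ μ : ℝ, (μ : ℂ) ∈ spectrum ℂ W.T ∧
            l = Complex.exp (2 * Complex.I * phase θ μ)}) ∧
      (W.Reversible → θ ≠ Real.pi / 2 →
        spectrum ℂ ((W.U θ).restrict hAB) =
          {l | ∃ μ : ℝ, (μ : ℂ) ∈ spectrum ℂ W.T ∧ μ ≠ 1 ∧
            l = Complex.exp (2 * Complex.I * phase θ μ)}) ∧
      (W.Reversible → θ = Real.pi / 2 →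
        spectrum ℂ ((W.U θ).restrict hAB) =
          {l | ∃ μ : ℝ, (μ : ℂ) ∈ spectrum ℂ W.T ∧ μ ≠ -1 ∧
            l = Complex.exp (2 * Complex.I * phase θ μ)}) ∧
      -- the same for `θ > π/2` in terms of the branch with values in `[0, π]`
      (W.Reversible → Real.pi / 2 < θ →
        spectrum ℂ ((W.U θ).restrict hAB) =
          {l | ∃ μ : ℝ, (μ : ℂ) ∈ spectrum ℂ W.T ∧ μ ≠ -1 ∧
            l = Complex.exp (2 * Complex.I * Real.arccos (μ * Real.sin θ))}) ∧
      -- the eigenspaces on `𝒜 + ℬ`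
      (∀ φ : ℝ,
        Complex.exp (2 * Complex.I * φ) ≠ Complex.exp (2 * Complex.I * phiMinus θ) →
        (((Module.End.eigenspace ((W.U θ).restrict hAB) (Complex.exp (2 * Complex.I * φ))).map
            (W.spaceA ⊔ W.spaceB).subtype : Submodule ℂ (EuclideanSpace ℂ V)) :
            Set (EuclideanSpace ℂ V)) =
          {ψ | ∃ (f : W.T₁.Tile → ℂ) (g : W.T₂.Tile → ℂ),
            Sum.elim f g ∈ LinearMap.ker (Matrix.mulVecLin
              (((Real.cos φ / Real.sin θ : ℝ) : ℂ) •
                (1 : Matrix (W.T₁.Tile ⊕ W.T₂.Tile) (W.T₁.Tile ⊕ W.T₂.Tile) ℂ) - W.T)) ∧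
            ψ = W.liftA f +
              (Complex.I * Complex.exp (Complex.I * ((θ : ℂ) + φ))) • W.liftB g}) ∧
      (∀ φ : ℝ,
        Complex.exp (2 * Complex.I * φ) = Complex.exp (2 * Complex.I * phiMinus θ) →
        (W.Reversible →
          (Module.End.eigenspace ((W.U θ).restrict hAB) (Complex.exp (2 * Complex.I * φ))).map
            (W.spaceA ⊔ W.spaceB).subtype = W.spaceA ⊓ W.spaceB) ∧
        (¬ W.Reversible →
          Module.End.eigenspace ((W.U θ).restrict hAB) (Complex.exp (2 * Complex.I * φ)) = ⊥)) ∧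
      (∀ ϖ, W.IsReversibleEigenfunction ϖ →
        W.T *ᵥ ϖ = ϖ ∧
        W.spaceA ⊓ W.spaceB = Submodule.span ℂ {W.liftA fun i => ϖ (Sum.inl i)}) ∧
      -- the spectrum on `(𝒜 + ℬ)ᗮ`
      (IsMultiTree W.underlying ∨ (W.betti = 1 ∧ ¬ W.Reversible) →
        spectrum ℂ ((W.U θ).restrict hperp) = ∅) ∧
      (¬ (IsMultiTree W.underlying ∨ (W.betti = 1 ∧ ¬ W.Reversible)) →
        spectrum ℂ ((W.U θ).restrict hperp) = {-Complex.exp (-2 * Complex.I * θ)}) ∧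
      -- the dimension of `(𝒜 + ℬ)ᗮ`
      (W.Reversible →
        (Module.finrank ℂ ((W.spaceA ⊔ W.spaceB)ᗮ : Submodule ℂ (EuclideanSpace ℂ V)) : ℤ) =
          W.betti) ∧
      (¬ W.Reversible →
        (Module.finrank ℂ ((W.spaceA ⊔ W.spaceB)ᗮ : Submodule ℂ (EuclideanSpace ℂ V)) : ℤ) =
          W.betti - 1) ∧
      -- the eigenspace on `(𝒜 + ℬ)ᗮ`, for the fundamental cycles of any spanning tree `S`
      (∀ S : Set V, IsSpanningTree W.underlying S →
        (∀ e ∉ S, ∃ (x : W.T₁.Tile ⊕ W.T₂.Tile) (c : MultiWalk W.underlying x x),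
          IsFundamentalCycle S e c) ∧
        (W.Reversible →
          ∀ (x : (Sᶜ : Set V) → W.T₁.Tile ⊕ W.T₂.Tile)
            (c : ∀ e : (Sᶜ : Set V), MultiWalk W.underlying (x e) (x e)),
            (∀ e : (Sᶜ : Set V), IsFundamentalCycle S (e : V) (c e)) →
            (∀ e, {u | W.cycleVec (c e) u ≠ 0} = {u | u ∈ (c e).edges}) ∧
            (Module.End.eigenspace ((W.U θ).restrict hperp)
                (-Complex.exp (-2 * Complex.I * θ))).map
              ((W.spaceA ⊔ W.spaceB)ᗮ : Submodule ℂ (EuclideanSpace ℂ V)).subtype =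
              Submodule.span ℂ (Set.range fun e => W.cycleVec (c e))) ∧
        (¬ W.Reversible →
          -- some fundamental cycle is unbalanced
          (∃ e₀ ∉ S, ∀ (x : W.T₁.Tile ⊕ W.T₂.Tile) (c : MultiWalk W.underlying x x),
            IsFundamentalCycle S e₀ c → W.balance c ≠ 0) ∧
          -- any unbalanced fundamental cycle can serve as `c₀`
          ∀ e₀ ∉ S,
            (∀ (x : W.T₁.Tile ⊕ W.T₂.Tile) (c : MultiWalk W.underlying x x),
              IsFundamentalCycle S e₀ c → W.balance c ≠ 0) →
            (∀ e ∉ S, e ≠ e₀ →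
              (∃ D : W.CyclePath S e₀ e, ∀ u ∈ D.p.edges, u ∈ S) ∧
              ∀ D : W.CyclePath S e₀ e,
                W.cyclePathVec D ≠ 0 ∧
                W.cyclePathVec D ∈ (Module.End.eigenspace ((W.U θ).restrict hperp)
                    (-Complex.exp (-2 * Complex.I * θ))).map
                  ((W.spaceA ⊔ W.spaceB)ᗮ : Submodule ℂ (EuclideanSpace ℂ V)).subtype ∧
                (W.balance D.c ≠ 0 → (∀ u ∈ D.c₀.edges, u ∉ D.c.edges) →
                  {u | W.cyclePathVec D u ≠ 0} =
                    {u | u ∈ D.c₀.edges ∨ u ∈ D.p.edges ∨ u ∈ D.c.edges})) ∧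
            ∀ D : ∀ e : {e : V // e ∉ S ∧ e ≠ e₀}, W.CyclePath S e₀ e,
              (∀ e, ∀ u ∈ (D e).p.edges, u ∈ S) →
              (Module.End.eigenspace ((W.U θ).restrict hperp)
                  (-Complex.exp (-2 * Complex.I * θ))).map
                ((W.spaceA ⊔ W.spaceB)ᗮ : Submodule ℂ (EuclideanSpace ℂ V)).subtype =
                Submodule.span ℂ (Set.range fun e => W.cyclePathVec (D e)))) := by
  have hne := hG.nonempty
  refine ⟨W.U_mem_sup θ, W.U_mem_orthogonal θ, Submodule.isCompl_orthogonal _,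
    W.spectrum_sup_of_not_reversible hθ _, fun _ h => W.spectrum_sup_of_ne hθ _ h,
    W.spectrum_sup_pi_div_two hθ _, fun _ h => W.spectrum_sup_of_lt hθ _ h,
    fun φ hφ => W.map_eigenspace_sup hθ _ hφ, fun φ hφ => ⟨fun _ => ?_, fun hW => ?_⟩,
    fun ϖ h => ⟨h.T_mulVec, h.inf_eq_span hG⟩,
    fun h => W.spectrum_orthogonal_eq_empty θ _ ((W.orthogonal_eq_bot_iff hG).2 h),
    fun h => W.spectrum_orthogonal_eq_singleton θ _ fun h' => h ((W.orthogonal_eq_bot_iff hG).1 h'),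
    W.finrank_orthogonal_of_reversible hG, W.finrank_orthogonal_of_not_reversible,
    fun S hS => ⟨fun e he => hS.exists_isFundamentalCycle (Set.mem_univ e) he,
      fun hW x c hc => ⟨fun e => ?_, ?_⟩, fun hW => ⟨W.exists_unbalanced hW hS,
      fun e₀ he₀ hb => ⟨fun e he hee => ⟨W.exists_cyclePath hS he₀ he, fun D => ⟨?_, ?_, ?_⟩⟩,
        fun D hD => ?_⟩⟩⟩⟩
  · exact W.map_eigenspace_sup_of_eq hθ _ hφ
  · have h := W.map_eigenspace_sup_of_eq hθ (W.U_mem_sup θ) hφ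
    rw [W.inf_eq_bot hW] at h
    exact Submodule.map_injective_of_injective (Submodule.injective_subtype _)
      (h.trans (Submodule.map_bot _).symm)
  · ext u
    exact W.cycleVec_apply_ne_zero_iff (hc e).isCycle u
  · rw [W.map_eigenspace_orthogonal]
    exact W.orthogonal_eq_span_cycleVec hS hc
      fun e => W.balance_eq_zero_of_reversible hG hW (c e)
  · intro h
    exact W.cyclePathVec_apply_ne_zero D he hee (hb _ _ D.fund₀) (by rw [h]; rfl)
  · rw [W.map_eigenspace_orthogonal]
    exact W.cyclePathVec_mem_orthogonal D
  · exact fun h hdisj => W.support_cyclePathVec D (hb _ _ D.fund₀) h hdisj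
  · rw [W.map_eigenspace_orthogonal]
    exact W.orthogonal_eq_span_cyclePathVec hS he₀ hb D hD
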